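/- Let $L\ge 0$, let $M\ge 0$ groups with $N_1,\dots,N_M$ data items be given, let $\gamma^l,\alpha^l>0$ for $l=0,\dots,L$, let $\bar H$ be a probability measure on a measurable space $\Theta$ of topics, and let $F$ be a Markov kernel from $\Theta$ to a measurable space $\mathcal X$ of data values. Restaurants of level $L$ are the $M$ groups; restaurants of level $l<L$ are the dishes of level $l+1$. *Finite table/dish process.* Let $K^l\ge 1$ be the number of dishes of level $l$, put $K^{L+1}=M$, and let $T^l_r\ge 1$ be the number of tables in restaurant $r\in\{1,\dots,K^{l+1}\}$ of level $l$. Independently for all levels $l=0,\dots,L$ draw $$\beta^l\sim \mathrm{Dir}\Big(\tfrac{\gamma^l}{K^l},\dots,\tfrac{\gamma^l}{K^l}\Big),\qquad \pi^l_r\sim \mathrm{Dir}\Big(\tfrac{\alpha^l}{T^l_r},\dots,\tfrac{\alpha^l}{T^l_r}\Big),\qquad k^l_{rt}\mid\beta^l\sim\beta^l\quad (1\le r\le K^{l+1},\ 1\le t\le T^l_r),$$ and topics $\phi_k\sim\bar H$ independently. Each data item $i\le N_j$ of group $j$ independently draws a table $t^L_{ji}\sim\pi^L_j$ and takes the dish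 $z^L_{ji}=k^L_{j\,t^L_{ji}}$; then for $l=L-1,\dots,0$, with $r=z^{l+1}_{ji}$, it draws a table $t^l_{ji}\sim\pi^l_r$ and takes the dish $z^l_{ji}=k^l_{r\,t^l_{ji}}$; finally $\theta^0_{ji}=\phi_{z^0_{ji}}$ and $x_{ji}\sim F(\theta^0_{ji})$. *Nested hierarchical Dirichlet process (nHDP).* Independently for all levels draw $\beta^l\sim\mathrm{GEM}(\gamma^l)$ and, given $\beta^l$, independent probability measures $\pi^l_r\sim \mathrm{DP}(\alpha^l,\beta^l)$ on $\{1,2,\dots\}$ for all restaurants $r$; draw topics $\phi_k\sim\bar H$ independently; for each data item independently draw $z^L_{ji}\sim\pi^L_j$, then $z^l_{ji}\sim\pi^l_{z^{l+1}_{ji}}$ for $l=L-1,\dots,0$, put $\theta^0_{ji}=\phi_{z^0_{ji}}$, and draw $x_{ji}\sim F(\theta^0_{ji})$. The outcome of either process, irrespective of how dishes are numbered, consists of: for every level $l$ the relation "$z^l_{ji}=z^l_{j'i'}$" on the set of all data items, all the topics $\theta^0_{ji}$, and all the data $x_{ji}$. Then, as $K^l\to\infty$ and $T^l_r\to\infty$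 at every level, the finite process converges to the nHDP: the joint law of the outcome of the finite process converges in total variation to the joint law of the outcome of the nHDP. Precisely, for every $\varepsilon>0$ there is $n$ such that, whenever $K^l\ge n$ for all $l\in\{0,\dots,L\}$ and $T^l_r\ge n$ for all $l$ and all $r\in\{1,\dots,K^{l+1}\}$, the probabilities of every measurable set of outcomes under the two processes differ by at most $\varepsilon$. -/

import Mathlib

open MeasureTheory ProbabilityTheory

noncomputable section

namespace NHDP

/-- The discrete measure `∑ k, w k • δ_{φ k}`, with weights `w` and atoms `φ`. -/
def atomic {X : Type*} [MeasurableSpace X] (w : ℕ → ℝ) (φ : ℕ → X) : Measure X :=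
  Measure.sum fun k => ENNReal.ofReal (w k) • Measure.dirac (φ k)

/-- The law on `ℕ` with weights `w`: index `k` has probability `w k`. -/
def categorical (w : ℕ → ℝ) : Measure ℕ :=
  atomic w id

/-- The law of infinitely many independent draws from `μ`. -/
def iid {X : Type*} [MeasurableSpace X] (μ : Measure X) : Measure (ℕ → X) :=
  Measure.infinitePi fun _ : ℕ => μ

/-! ### Dirichlet weights, stick-breaking weights, Dirichlet processes -/

/-- The Dirichlet distribution `Dir(a₁, …, aₙ)` (all `aᵢ > 0`): the law of independent
`Gamma(aᵢ, 1)` variables divided by their sum. -/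
def dirichlet {n : ℕ} (a : Fin n → ℝ) : Measure (Fin n → ℝ) :=
  (Measure.pi fun i => gammaMeasure (a i) 1).map fun g i => g i / ∑ j, g j

/-- The symmetric Dirichlet distribution `Dir(c/n, …, c/n)` on weight sequences indexed by
`0, 1, …, n - 1`; a weight sequence is read as a function on `ℕ`, zero from `n` on. -/
def symDirichlet (c : ℝ) (n : ℕ) : Measure (ℕ → ℝ) :=
  (dirichlet fun _ : Fin n => c / n).map fun w k => if h : k < n then w ⟨k, h⟩ else 0

/-- The stick-breaking distribution `GEM(c)`: the law of `w k = v k * ∏ i < k, (1 - v i)` with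
`v i ∼ Beta(1, c)` independent. -/
def gem (c : ℝ) : Measure (ℕ → ℝ) :=
  (iid (betaMeasure 1 c)).map fun v k => v k * ∏ i ∈ Finset.range k, (1 - v i)

/-- The Dirichlet process `DP(c, H)` with concentration `c` and base distribution `H`: the law of
the random measure `∑ k, w k • δ_{φ k}`, where `w ∼ GEM(c)` and the atoms `φ k ∼ H` are
independent. -/
def dirichletProcess {X : Type*} [MeasurableSpace X] (c : ℝ) (H : Measure X) :
    Measure (Measure X) :=
  ((gem c).prod (iid H)).map fun p => atomic p.1 p.2

/-! ### One level: the random dish distributions of its restaurants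

Restaurants, tables and dishes are numbered by `ℕ`, starting from `0`. What a level contributes is
the family `G : ℕ → Measure ℕ`; a customer who enters restaurant `r` of that level gets dish `k`
with probability `G r {k}`. -/

/-- A restaurant with `n` tables, when dishes have law `β`: the table weights are
`π ∼ Dir(c/n, …, c/n)`, table `t` serves a dish `k t ∼ β`, all independent. A customer chooses a
table `t ∼ π` and gets the dish `k t`; given `(π, k)`, this dish has the law `π.map k`. -/
def tableRestaurant (c : ℝ) (n : ℕ) (β : Measure ℕ) : Measure (Measure ℕ) :=
  ((symDirichlet c n).prod (iid β)).map fun p => (categorical p.1).map p.2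

/-- A level of the finite table/dish model with `K` dishes and `T r` tables in restaurant `r`:
`β ∼ Dir(γ/K, …, γ/K)` and, given `β`, independent restaurants. -/
def finiteLevel (γ α : ℝ) (K : ℕ) (T : ℕ → ℕ) : Measure (ℕ → Measure ℕ) :=
  (symDirichlet γ K).bind fun b =>
    Measure.infinitePi fun r : ℕ => tableRestaurant α (T r) (categorical b)

/-- A level of the nested hierarchical Dirichlet process: `β ∼ GEM(γ)` and, given `β`, independent
`G r ∼ DP(α, β)` for all `r`. -/
def nHDPLevel (γ α : ℝ) : Measure (ℕ → Measure ℕ) :=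
  (gem γ).bind fun b =>
    Measure.infinitePi fun _r : ℕ => dirichletProcess α (categorical b)

/-! ### The customers

The levels are `0, …, L`, and level `L` is the outermost one: its restaurants `0, …, M - 1` are the
observed groups. The dishes of level `l + 1` are the restaurants of level `l`. -/

/-- The data items: item `i < N j` of group `j < M`. -/
abbrev Customer (M : ℕ) (N : Fin M → ℕ) : Type :=
  Σ j : Fin M, Fin (N j)

/-- The restaurant of level `l` entered by a customer of group `j` with dishes `z`: the dish
`z (l + 1)` if `l < L`, and the group `j` at the outermost level `l = L`. -/
def restaurant {L : ℕ} (j : ℕ) (z : Fin (L + 1) → ℕ) (l : Fin (L + 1)) : ℕ :=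
  if h : (l : ℕ) + 1 < L + 1 then z ⟨l + 1, h⟩ else j

/-- The joint law of the dishes `z c l` of all customers `c` at all levels `l`, given the dish
distributions `G l r` of all restaurants. Customers are independent; each starts in the restaurant
of his group, and goes down from level `L` to level `0`, drawing his dish at level `l` from `G l r`
with `r` the restaurant that he enters there. The probability of `z` is the product of the
probabilities of these draws. -/
def routing {L M : ℕ} (N : Fin M → ℕ) (G : Fin (L + 1) → ℕ → Measure ℕ) :
    Measure (Customer M N → Fin (L + 1) → ℕ) :=
  Measure.sum fun z =>
    (∏ c, ∏ l, G l (restaurant c.1 (z c) l) {z c l}) • Measure.dirac z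

/-- What is observed of a process, irrespective of the numbering of dishes: for each level, which
pairs of customers have the same dish; the topic of each customer; the datum of each customer. -/
abbrev Outcome (L M : ℕ) (N : Fin M → ℕ) (Θ X : Type*) : Type _ :=
  (Fin (L + 1) → Customer M N → Customer M N → Prop) × (Customer M N → Θ) × (Customer M N → X)

/-- The law of the outcome, when the levels are independent with laws `level l`. The topics
`φ k ∼ H` are independent of each other and of the dishes `z`; customer `c` has the topic
`φ (z c 0)` and, independently of the others given the topics, a datum drawn from `F (φ (z c 0))`.
-/
def outcomeLaw {L M : ℕ} (N : Fin M → ℕ) {Θ X : Type*} [MeasurableSpace Θ] [MeasurableSpace X]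
    (level : Fin (L + 1) → Measure (ℕ → Measure ℕ)) (H : Measure Θ) (F : Kernel Θ X) :
    Measure (Outcome L M N Θ X) :=
  (((Measure.pi level).bind (routing N)).prod (iid H)).bind fun p =>
    (Measure.pi fun c => F (p.2 (p.1 c 0))).map fun x =>
      (fun l c c' => p.1 c l = p.1 c' l, fun c => p.2 (p.1 c 0), x)

/-- The finite multi-level table/dish process with `K l` dishes at level `l`, and `T l r` tables in
restaurant `r` of level `l`. -/
def finiteLaw {L M : ℕ} (N : Fin M → ℕ) {Θ X : Type*} [MeasurableSpace Θ] [MeasurableSpace X]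
    (γ α : Fin (L + 1) → ℝ) (H : Measure Θ) (F : Kernel Θ X)
    (K : Fin (L + 1) → ℕ) (T : Fin (L + 1) → ℕ → ℕ) : Measure (Outcome L M N Θ X) :=
  outcomeLaw N (fun l => finiteLevel (γ l) (α l) (K l) (T l)) H F

/-- The nested hierarchical Dirichlet process with levels `0, …, L`. -/
def nHDPLaw {L M : ℕ} (N : Fin M → ℕ) {Θ X : Type*} [MeasurableSpace Θ] [MeasurableSpace X]
    (γ α : Fin (L + 1) → ℝ) (H : Measure Θ) (F : Kernel Θ X) : Measure (Outcome L M N Θ X) :=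
  outcomeLaw N (fun l => nHDPLevel (γ l) (α l)) H F

/-- The number of restaurants at level `l` of the finite process: the number of dishes at level
`l + 1` if `l < L`, and the number `M` of groups if `l = L`. -/
def numRestaurants {L : ℕ} (M : ℕ) (K : Fin (L + 1) → ℕ) (l : Fin (L + 1)) : ℕ :=
  restaurant M K l

end NHDP

end

namespace NHDP

open Filter Topology
open scoped ENNReal Classical

noncomputable section

/-! ### Products of integrals and of sums -/

/-! The outcome sees the dish numbers only through the partitions `R l` of the customers that they
induce. Given these partitions, the topics are independent draws from `H`, one per block of `R 0`,
and the data are drawn from the topics. This conditional law is the same in both processes. Hence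
each law of the outcome is a finite mixture over `R` (`outcomeLaw_apply`), and total variation
convergence follows from convergence of the finitely many weights `dishPartitionProb`.

From the outermost level inward, the weight is a product of transition probabilities from the
partition by restaurants to the partition by dishes (`chain_mem_Icc`). For the nHDP this is exact.
In the finite process a transition depends also on the table counts of the restaurants entered, so
uniform two-sided bounds are multiplied instead.

One transition is a two-stage sampling scheme shared by both models. In each restaurant the
customers are partitioned into tables by sampling from the table weights; then all occupied tables
of the level draw independent dishes from the common dish weights. The transition probability is
therefore a finite sum of finite products of partition probabilities of random weight sequences
(`levelPartitionProb`, `tsum_lintegral_levelLaw`).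

It remains to see that the partition probabilities of `Dir(c/K, …, c/K)` converge to those of
`GEM(c)`. Write `n i` for the sizes of the `k` blocks and `S` for their sum. Dirichlet moments give
`K(K-1)⋯(K-k+1) * Γ(c)/Γ(c+S) * ∏ Γ(c/K + n i)/Γ(c/K)`. Since `Γ(c/K) = (K/c) * Γ(c/K + 1)`, this
tends to the Ewens formula `c^k * Γ(c)/Γ(c+S) * ∏ Γ(n i)`. Stick-breaking weights satisfy the Ewens
formula exactly, by induction on the number of blocks after splitting off the first stick
(`lintegral_gem_distinctSum`). -/

theorem lintegral_fin_prod_eq_prod {n : ℕ} {E : Fin n → Type*} {mE : ∀ i, MeasurableSpace (E i)}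
    {μ : (i : Fin n) → Measure (E i)} [∀ i, SigmaFinite (μ i)]
    (f : (i : Fin n) → E i → ℝ≥0∞) (hf : ∀ i, Measurable (f i)) :
    ∫⁻ x : (i : Fin n) → E i, ∏ i, f i (x i) ∂(Measure.pi μ) = ∏ i, ∫⁻ x, f i x ∂(μ i) := by
  induction n with
  | zero => simp
  | succ n ih =>
    have h := (measurePreserving_piFinSuccAbove μ 0).symm.lintegral_comp_emb
      (MeasurableEquiv.measurableEmbedding _) (fun x => ∏ i, f i (x i))
    rw [← h]
    have h2 : ∀ a : E 0 × ((i : Fin n) → E (Fin.succ i)),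
        (∏ i, f i ((MeasurableEquiv.piFinSuccAbove E 0).symm a i)) =
          f 0 a.1 * ∏ i : Fin n, f (Fin.succ i) (a.2 i) := by
      intro a
      rw [Fin.prod_univ_succ]
      rfl
    calc _ = ∫⁻ a : E 0 × ((i : Fin n) → E (Fin.succ i)),
            f 0 a.1 * ∏ i : Fin n, f (Fin.succ i) (a.2 i)
            ∂((μ 0).prod (Measure.pi (fun i ↦ μ i.succ))) := lintegral_congr h2
      _ = (∫⁻ x, f 0 x ∂μ 0)
            * ∏ i : Fin n, ∫⁻ (x : E (Fin.succ i)), f (Fin.succ i) x ∂(μ i.succ) := by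
          rw [← ih _ fun i => hf _, ← lintegral_prod_mul (hf 0).aemeasurable]
          exact (Finset.measurable_prod _ fun i _ =>
            (hf _).comp (measurable_pi_apply i)).aemeasurable
      _ = _ := by rw [Fin.prod_univ_succ]

theorem lintegral_fintype_prod_eq_prod {ι : Type*} [Fintype ι] {E : ι → Type*}
    {mE : ∀ i, MeasurableSpace (E i)}
    {μ : (i : ι) → Measure (E i)} [∀ i, SigmaFinite (μ i)]
    (f : (i : ι) → E i → ℝ≥0∞) (hf : ∀ i, Measurable (f i)) :
    ∫⁻ x : (i : ι) → E i, ∏ i, f i (x i) ∂(Measure.pi μ) = ∏ i, ∫⁻ x, f i x ∂(μ i) := by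
  let e := (Fintype.equivFin ι).symm
  rw [← (measurePreserving_piCongrLeft _ e).lintegral_comp_emb
    (MeasurableEquiv.measurableEmbedding _)]
  simp_rw [← e.prod_comp, MeasurableEquiv.coe_piCongrLeft, Equiv.piCongrLeft_apply_apply]
  exact lintegral_fin_prod_eq_prod _ fun i => hf _

/-- Distributivity is Tonelli's theorem for counting measures. -/
theorem tsum_pi_prod {ι : Type*} [Fintype ι] {α : ι → Type*} [∀ i, Countable (α i)]
    (f : ∀ i, α i → ℝ≥0∞) : ∑' x : ∀ i, α i, ∏ i, f i (x i) = ∏ i, ∑' a, f i a := by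
  let _ : ∀ i, MeasurableSpace (α i) := fun _ => ⊤
  have h := lintegral_fintype_prod_eq_prod (μ := fun i => (Measure.count : Measure (α i))) f
    fun i => measurable_from_top
  simpa [lintegral_countable', Measure.pi_singleton] using h

theorem tsum_finsetSum_comm {α β : Type*} [Fintype β] (f : β → α → ℝ≥0∞) :
    ∑' a, ∑ b, f b a = ∑ b, ∑' a, f b a := by
  simp_rw [← tsum_fintype (L := .unconditional _)]
  rw [ENNReal.tsum_comm]

theorem lintegral_infinitePi_prod {X : Type*} [MeasurableSpace X] {Q : Type*} [Fintype Q]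
    (μ : ℕ → Measure X) [∀ i, IsProbabilityMeasure (μ i)] (ρ : Q → ℕ) (hρ : Function.Injective ρ)
    (f : Q → X → ℝ≥0∞) (hf : ∀ i, Measurable (f i)) :
    ∫⁻ x, ∏ q, f q (x (ρ q)) ∂(Measure.infinitePi μ) = ∏ q, ∫⁻ x, f q x ∂(μ (ρ q)) := by
  have h1 : iIndepFun (fun i (ω : ℕ → X) => ω i) (Measure.infinitePi μ) :=
    iIndepFun_infinitePi (X := fun _ x => x) fun _ => measurable_id
  have h2 := (h1.precomp hρ).comp f hf
  have h3 := lintegral_prod_eq_prod_lintegral_of_indepFun Finset.univ _ h2 fun i => by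
    exact (hf i).comp (measurable_pi_apply _)
  simp only [Function.comp_def] at h3
  rw [h3]
  refine Finset.prod_congr rfl fun q _ => ?_
  rw [← Measure.infinitePi_map_eval μ (ρ q), lintegral_map (hf q) (measurable_pi_apply _)]

/-! ### Moments of the Dirichlet distribution -/

/-- The factor `x ^ m * exp (-(t * x))` turns the `Gamma(a, 1)` density into a multiple of the
`Gamma(a + m, 1 + t)` density, whose integral is 1. -/
theorem lintegral_gammaMeasure_pow_mul_exp {a t : ℝ} (ha : 0 < a) (ht : 0 ≤ t) (m : ℕ) :
    ∫⁻ x, ENNReal.ofReal (x ^ m * Real.exp (-(t * x))) ∂(gammaMeasure a 1) =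
      ENNReal.ofReal (Real.Gamma (a + m) / Real.Gamma a * (1 + t) ^ (-(a + m))) := by
  have hm : 0 < a + m := by positivity
  have ht1 : 0 < 1 + t := by positivity
  have hG := Real.Gamma_pos_of_pos ha
  have hGm := Real.Gamma_pos_of_pos hm
  rw [gammaMeasure, lintegral_withDensity_eq_lintegral_mul _ (by unfold gammaPDF; fun_prop)
    (by fun_prop)]
  have h : ∀ᵐ x : ℝ, gammaPDF a 1 x * ENNReal.ofReal (x ^ m * Real.exp (-(t * x))) =
      ENNReal.ofReal (Real.Gamma (a + m) / Real.Gamma a * (1 + t) ^ (-(a + m))) *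
        gammaPDF (a + m) (1 + t) x := by
    filter_upwards [compl_mem_ae_iff.2 (measure_singleton (0 : ℝ))] with x hx
    rcases lt_or_gt_of_ne (show x ≠ 0 from hx) with hx | hx
    · simp [gammaPDF_of_neg hx]
    · rw [gammaPDF_of_nonneg hx.le, gammaPDF_of_nonneg hx.le, ← ENNReal.ofReal_mul (by positivity),
        ← ENNReal.ofReal_mul (by positivity)]
      congr 1
      rw [show a + m - 1 = (a - 1) + m by ring, Real.rpow_add hx, Real.rpow_natCast,
        Real.rpow_neg ht1.le, show -((1 + t) * x) = -(1 * x) + -(t * x) by ring, Real.exp_add]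
      have := Real.rpow_pos_of_pos ht1 (a + m)
      simp only [Real.one_rpow]
      field_simp
  simp only [Pi.mul_apply]
  rw [lintegral_congr_ae h, lintegral_const_mul _ (by unfold gammaPDF; fun_prop),
    lintegral_gammaPDF_eq_one hm ht1, mul_one]

theorem ae_gammaMeasure_pos (a r : ℝ) : ∀ᵐ x ∂(gammaMeasure a r), 0 < x := by
  rw [gammaMeasure, ae_withDensity_iff (by unfold gammaPDF; fun_prop)]
  filter_upwards [compl_mem_ae_iff.2 (measure_singleton (0 : ℝ))] with x hx h
  by_contra h'
  exact h (gammaPDF_of_neg (lt_of_le_of_ne (not_lt.1 h') hx))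

theorem ae_pi_gammaMeasure_pos {n : ℕ} {a : Fin n → ℝ} (ha : ∀ i, 0 < a i) :
    ∀ᵐ g ∂(Measure.pi fun i => gammaMeasure (a i) 1), ∀ i, 0 < g i := by
  have := fun i => isProbabilityMeasure_gammaMeasure (ha i) one_pos
  rw [ae_all_iff]
  intro i
  exact (measurePreserving_eval (fun i => gammaMeasure (a i) 1) i).quasiMeasurePreserving.ae
    (ae_gammaMeasure_pos (a i) 1)

/-- The integral of `tⁿ⁻¹ / Γ(n) * (1 + t) ^ -(c + n)` over `t ≥ 0`: the normalizing factor of the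
`n`-th order moments of a Dirichlet distribution of total mass `c`. -/
def gammaTilt (c : ℝ) (n : ℕ) : ℝ≥0∞ :=
  ∫⁻ t in Set.Ici (0 : ℝ),
    ENNReal.ofReal (t ^ ((n : ℝ) - 1) / Real.Gamma n) * ENNReal.ofReal ((1 + t) ^ (-(c + n)))

theorem measurable_normalize (n : ℕ) :
    Measurable fun (g : Fin n → ℝ) i => g i / ∑ j, g j :=
  measurable_pi_lambda _ fun i => by fun_prop

/-- The common denominator is decoupled by `s ^ (-N) = ∫ t ^ (N - 1) / Γ(N) * exp (-(t * s)) dt`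
over `t ≥ 0`, with `s` the sum of the gamma variables. For fixed `t` the integrand is a product over
independent coordinates. What remains of the integral over `t` depends only on the total mass and
the order `N`; positivity of `N` makes `Γ(N)` usable. -/
theorem lintegral_dirichlet_eq_gammaTilt {n : ℕ} {a : Fin n → ℝ} (ha : ∀ i, 0 < a i)
    (m : Fin n → ℕ) (hm : 0 < ∑ i, m i) :
    ∫⁻ w, ∏ i, ENNReal.ofReal (w i) ^ m i ∂(dirichlet a) =
      (∏ i, ENNReal.ofReal (Real.Gamma (a i + m i) / Real.Gamma (a i))) *
        gammaTilt (∑ i, a i) (∑ i, m i) := by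
  have := fun i => isProbabilityMeasure_gammaMeasure (ha i) one_pos
  rw [dirichlet, lintegral_map (by fun_prop) (measurable_normalize n)]
  set N := ∑ i, m i with hN
  have hN' : (0 : ℝ) < N := by exact_mod_cast hm
  have hne : Nonempty (Fin n) := by
    by_contra h
    rw [not_nonempty_iff] at h
    simp [N] at hm
  have h : ∀ᵐ g ∂(Measure.pi fun i => gammaMeasure (a i) 1),
      ∏ i, ENNReal.ofReal (g i / ∑ j, g j) ^ m i =
        ∫⁻ t in Set.Ici (0 : ℝ), ENNReal.ofReal (t ^ ((N : ℝ) - 1) / Real.Gamma N) *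
          ∏ i, ENNReal.ofReal (g i ^ m i * Real.exp (-(t * g i))) := by
    filter_upwards [ae_pi_gammaMeasure_pos ha] with g hg
    have hS : 0 < ∑ j, g j := Finset.sum_pos (fun i _ => hg i) Finset.univ_nonempty
    have h1 : ∏ i, ENNReal.ofReal (g i / ∑ j, g j) ^ m i =
        ENNReal.ofReal ((∏ i, g i ^ m i) / (∑ j, g j) ^ (N : ℝ)) := by
      rw [Real.rpow_natCast, hN, ← Finset.prod_pow_eq_pow_sum, ← Finset.prod_div_distrib,
        ENNReal.ofReal_prod_of_nonneg fun i _ => by have := hg i; positivity]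
      refine Finset.prod_congr rfl fun i _ => ?_
      rw [← ENNReal.ofReal_pow (by have := hg i; positivity), div_pow]
    have hG := Real.Gamma_pos_of_pos hN'
    -- The integral representation of the power, written as the normalization of the gamma density
    -- of shape `N` and rate the sum of the `g j`.
    have h2 : ∫⁻ t in Set.Ici (0 : ℝ), gammaPDF N (∑ j, g j) t = 1 := by
      rw [← lintegral_gammaPDF_eq_one hN' hS, ← lintegral_indicator measurableSet_Ici]
      refine lintegral_congr fun t => ?_
      by_cases ht : 0 ≤ t
      · simp [ht]
      · rw [gammaPDF_of_neg (not_le.1 ht), Set.indicator_of_notMem (by simpa using ht)]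
    rw [h1, ← mul_one (ENNReal.ofReal _), ← h2,
      ← lintegral_const_mul _ (by unfold gammaPDF; fun_prop)]
    refine setLIntegral_congr_fun measurableSet_Ici fun t (ht : 0 ≤ t) => ?_
    have h3 := Real.rpow_pos_of_pos hS N
    have h4 := fun i => hg i
    have h5 : 0 ≤ ∏ i, g i ^ m i := Finset.prod_nonneg fun i _ => by have := hg i; positivity
    have h6 := Real.rpow_nonneg ht ((N : ℝ) - 1)
    rw [gammaPDF_of_nonneg ht, ← ENNReal.ofReal_mul (by positivity),
      ← ENNReal.ofReal_prod_of_nonneg fun i _ => by have := hg i; positivity,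
      ← ENNReal.ofReal_mul (by positivity), Finset.prod_mul_distrib, ← Real.exp_sum,
      Finset.sum_neg_distrib, ← Finset.mul_sum, mul_comm t]
    congr 1
    field_simp
  rw [lintegral_congr_ae h, lintegral_lintegral_swap (by fun_prop), gammaTilt]
  rw [← lintegral_const_mul _ (by fun_prop)]
  refine setLIntegral_congr_fun measurableSet_Ici fun t (ht : 0 ≤ t) => ?_
  rw [lintegral_const_mul _ (by fun_prop), lintegral_fintype_prod_eq_prod
    (fun i x => ENNReal.ofReal (x ^ m i * Real.exp (-(t * x)))) (fun i => by fun_prop)]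
  simp_rw [lintegral_gammaMeasure_pow_mul_exp (ha _) ht]
  have h7 : ∀ i, 0 ≤ Real.Gamma (a i + m i) / Real.Gamma (a i) := fun i => by
    have := ha i
    have := Real.Gamma_pos_of_pos (ha i)
    have := Real.Gamma_pos_of_pos (show 0 < a i + m i by positivity)
    positivity
  have ht1 : 0 < 1 + t := by positivity
  simp_rw [fun i => ENNReal.ofReal_mul (q := (1 + t) ^ (-(a i + m i))) (h7 i)]
  rw [Finset.prod_mul_distrib, ← ENNReal.ofReal_prod_of_nonneg (s := Finset.univ)
    (f := fun i => (1 + t) ^ (-(a i + m i))) fun i _ => by positivity, ← Real.rpow_sum_of_pos ht1]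
  have h8 : ∑ i, (-(a i + (m i : ℝ))) = -(∑ i, a i + N) := by
    rw [Finset.sum_neg_distrib, Finset.sum_add_distrib, hN]; push_cast; rfl
  rw [h8]
  ring

theorem isProbabilityMeasure_dirichlet {n : ℕ} {a : Fin n → ℝ} (ha : ∀ i, 0 < a i) :
    IsProbabilityMeasure (dirichlet a) := by
  have := fun i => isProbabilityMeasure_gammaMeasure (ha i) one_pos
  exact Measure.isProbabilityMeasure_map (measurable_normalize n).aemeasurable

theorem ae_dirichlet {n : ℕ} (hn : 0 < n) {a : Fin n → ℝ} (ha : ∀ i, 0 < a i) :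
    ∀ᵐ w ∂(dirichlet a), (∀ i, 0 < w i) ∧ ∑ i, w i = 1 := by
  have hS : MeasurableSet {w : Fin n → ℝ | (∀ i, 0 < w i) ∧ ∑ i, w i = 1} := by measurability
  rw [dirichlet, ae_map_iff (measurable_normalize n).aemeasurable hS]
  filter_upwards [ae_pi_gammaMeasure_pos ha] with g hg
  have : Nonempty (Fin n) := ⟨⟨0, hn⟩⟩
  have hS : 0 < ∑ j, g j := Finset.sum_pos (fun i _ => hg i) Finset.univ_nonempty
  exact ⟨fun i => div_pos (hg i) hS, by rw [← Finset.sum_div, div_self hS.ne']⟩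

/-- No integral has to be evaluated: the one-dimensional Dirichlet distribution is concentrated at
1, so its moments are 1, and the moment formula can be solved for the factor. -/
theorem gammaTilt_eq {c : ℝ} (hc : 0 < c) {n : ℕ} (hn : 0 < n) :
    gammaTilt c n = ENNReal.ofReal (Real.Gamma c / Real.Gamma (c + n)) := by
  have h := lintegral_dirichlet_eq_gammaTilt (n := 1) (a := fun _ => c) (fun _ => hc)
    (fun _ => n) (by simpa using hn)
  have h1 := Real.Gamma_pos_of_pos hc
  have h2 := Real.Gamma_pos_of_pos (show 0 < c + n by positivity)
  have := isProbabilityMeasure_dirichlet (n := 1) (a := fun _ => c) (fun _ => hc)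
  have h3 : ∫⁻ w, ∏ i : Fin 1, ENNReal.ofReal (w i) ^ n ∂(dirichlet fun _ : Fin 1 => c) = 1 := by
    have : ∀ᵐ w ∂(dirichlet fun _ : Fin 1 => c), ∏ i : Fin 1, ENNReal.ofReal (w i) ^ n = 1 := by
      filter_upwards [ae_dirichlet one_pos (a := fun _ : Fin 1 => c) fun _ => hc] with w hw
      have := hw.2
      simp at this
      simp [this]
    rw [lintegral_congr_ae this]; simp
  rw [h3] at h
  simp only [Finset.univ_unique, Finset.prod_const, Finset.card_singleton, pow_one,
    Finset.sum_const, one_smul] at h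
  have h4 : ENNReal.ofReal (Real.Gamma c / Real.Gamma (c + n)) *
      ENNReal.ofReal (Real.Gamma (c + n) / Real.Gamma c) = 1 := by
    rw [← ENNReal.ofReal_mul (by positivity)]
    rw [show Real.Gamma c / Real.Gamma (c + n) * (Real.Gamma (c + n) / Real.Gamma c) = 1 by
      field_simp]
    simp
  calc gammaTilt c n = (ENNReal.ofReal (Real.Gamma c / Real.Gamma (c + n)) *
      ENNReal.ofReal (Real.Gamma (c + n) / Real.Gamma c)) * gammaTilt c n := by rw [h4, one_mul]
    _ = _ := by rw [mul_assoc, ← h, mul_one]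

theorem lintegral_dirichlet {n : ℕ} (hn : 0 < n) {a : Fin n → ℝ} (ha : ∀ i, 0 < a i)
    (m : Fin n → ℕ) :
    ∫⁻ w, ∏ i, ENNReal.ofReal (w i) ^ m i ∂(dirichlet a) =
      ENNReal.ofReal (Real.Gamma (∑ i, a i) / Real.Gamma (∑ i, a i + (∑ i, m i : ℕ))) *
      ∏ i, ENNReal.ofReal (Real.Gamma (a i + m i) / Real.Gamma (a i)) := by
  have : Nonempty (Fin n) := ⟨⟨0, hn⟩⟩
  have hS : 0 < ∑ j, a j := Finset.sum_pos (fun i _ => ha i) Finset.univ_nonempty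
  -- The moment of order zero is separate, because the integral representation needs positive order.
  rcases Nat.eq_zero_or_pos (∑ i, m i) with h | h
  · have := isProbabilityMeasure_dirichlet ha
    have hm : ∀ i, m i = 0 := by simpa using h
    simp [hm, div_self (Real.Gamma_pos_of_pos hS).ne', div_self (Real.Gamma_pos_of_pos (ha _)).ne']
  · rw [lintegral_dirichlet_eq_gammaTilt ha m h, gammaTilt_eq hS h, mul_comm]

/-! ### Splitting off the first of infinitely many draws -/

/-- Prepend an entry to a sequence. -/
def seqCons {X : Type*} (p : X × (ℕ → X)) : ℕ → X
  | 0 => p.1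
  | k + 1 => p.2 k

theorem measurable_seqCons {X : Type*} [MeasurableSpace X] :
    Measurable (seqCons : X × (ℕ → X) → ℕ → X) := by
  refine measurable_pi_lambda _ fun k => ?_
  cases k with
  | zero => exact measurable_fst
  | succ k => exact (measurable_pi_apply k).comp measurable_snd

instance {X : Type*} [MeasurableSpace X] (μ : Measure X) [IsProbabilityMeasure μ] :
    IsProbabilityMeasure (iid μ) := by unfold iid; infer_instance

theorem map_seqCons_iid {X : Type*} [MeasurableSpace X] (μ : Measure X) [IsProbabilityMeasure μ] :
    (μ.prod (iid μ)).map seqCons = iid μ := by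
  refine Measure.eq_infinitePi _ fun s t ht => ?_
  -- The cylinder is rewritten over the initial segment `range (m + 1)`, with trivial conditions off
  -- `s`. The extra index guarantees that coordinate 0 is present and can be split off.
  obtain ⟨m, hm⟩ := s.exists_nat_subset_range
  set u : ℕ → Set X := fun i => if i ∈ s then t i else Set.univ with hu
  have hum : ∀ i, MeasurableSet (u i) := fun i => by
    simp only [hu]; split_ifs; exacts [ht i, .univ]
  have h1 : (s : Set ℕ).pi t = (Finset.range (m + 1) : Set ℕ).pi u := by
    ext x
    simp only [Set.mem_pi, hu]
    refine ⟨fun h i _ => ?_, fun h i hi => ?_⟩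
    · split_ifs with hi
      exacts [h i hi, trivial]
    · have := h i (Finset.range_mono m.le_succ (hm hi))
      rwa [if_pos (by exact hi)] at this
  have h2 : ∏ i ∈ s, μ (t i) = ∏ i ∈ Finset.range (m + 1), μ (u i) := by
    rw [← Finset.prod_subset (hm.trans (Finset.range_mono m.le_succ))]
    · exact Finset.prod_congr rfl fun i hi => by simp [hu, hi]
    · intro i _ hi; simp [hu, hi]
  have h3 : seqCons ⁻¹' (Finset.range (m + 1) : Set ℕ).pi u =
      u 0 ×ˢ (Finset.range m : Set ℕ).pi fun i => u (i + 1) := by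
    ext p
    simp only [Set.mem_preimage, Set.mem_pi, Finset.coe_range, Set.mem_Iio, Set.mem_prod]
    refine ⟨fun h => ⟨h 0 (by omega), fun i hi => h (i + 1) (by omega)⟩, fun h i hi => ?_⟩
    cases i with
    | zero => exact h.1
    | succ i => exact h.2 i (by omega)
  rw [h1, h2, Measure.map_apply measurable_seqCons (.pi (Finset.countable_toSet _) fun i _ => hum i),
    h3, Measure.prod_prod, iid, Measure.infinitePi_pi _ fun i _ => hum _, Finset.prod_range_succ',
    mul_comm]

/-! ### Sums over distinct indices -/

/-- The sum of `∏ i, x (f i) ^ n i` over all choices of distinct indices `f i`. -/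
def distinctSum {k : ℕ} (n : Fin k → ℕ) (x : ℕ → ℝ≥0∞) : ℝ≥0∞ :=
  ∑' f : Fin k ↪ ℕ, ∏ i, x (f i) ^ n i

theorem distinctSum_smul {k : ℕ} (n : Fin k → ℕ) (a : ℝ≥0∞) (x : ℕ → ℝ≥0∞) :
    distinctSum n (fun j => a * x j) = a ^ (∑ i, n i) * distinctSum n x := by
  simp_rw [distinctSum, mul_pow, Finset.prod_mul_distrib, Finset.prod_pow_eq_pow_sum,
    ENNReal.tsum_mul_left]

/-- Without the distinctness condition the sum factorizes, and for positive exponents each factor is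
at most the sum of the `x j`. -/
theorem distinctSum_le {k : ℕ} {n : Fin k → ℕ} (hn : ∀ i, 0 < n i) {x : ℕ → ℝ≥0∞}
    (hx : ∑' j, x j ≤ 1) : distinctSum n x ≤ 1 := by
  have h1 : ∀ i, ∑' j, x j ^ n i ≤ 1 := fun i => by
    refine (ENNReal.tsum_le_tsum fun j => ?_).trans hx
    exact pow_le_of_le_one zero_le ((ENNReal.le_tsum j).trans hx) (hn i).ne'
  calc distinctSum n x ≤ ∑' f : Fin k → ℕ, ∏ i, x (f i) ^ n i :=
        ENNReal.tsum_comp_le_tsum_of_injective (f := fun f : Fin k ↪ ℕ => (f : Fin k → ℕ))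
          DFunLike.coe_injective fun f : Fin k → ℕ => ∏ i, x (f i) ^ n i
    _ = ∏ i, ∑' j, x j ^ n i := tsum_pi_prod fun i j => x j ^ n i
    _ ≤ 1 := Finset.prod_le_one' fun i _ => h1 i

/-- Injections into `ℕ` from their shifts: either `0` is not a value, or it is the value of
exactly one argument. -/
def embeddingSplit {k : ℕ} :
    (Fin (k + 1) ↪ ℕ) ⊕ (Fin (k + 1) × (Fin k ↪ ℕ)) → (Fin (k + 1) ↪ ℕ)
  | .inl g => g.trans ⟨Nat.succ, Nat.succ_injective⟩
  | .inr (i, g) => ⟨i.insertNth 0 fun j => g j + 1, by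
      intro a b h
      rcases Fin.eq_self_or_eq_succAbove i a with ha | ⟨a, rfl⟩ <;>
        rcases Fin.eq_self_or_eq_succAbove i b with hb | ⟨b, rfl⟩
      · rw [ha, hb]
      · subst ha; simp at h
      · subst hb; simp at h
      · simpa using h⟩

theorem embeddingSplit_inl {k : ℕ} (g : Fin (k + 1) ↪ ℕ) (j : Fin (k + 1)) :
    embeddingSplit (.inl g) j = g j + 1 := rfl

theorem embeddingSplit_inr_self {k : ℕ} (i : Fin (k + 1)) (g : Fin k ↪ ℕ) :
    embeddingSplit (.inr (i, g)) i = 0 :=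
  Fin.insertNth_apply_same (α := fun _ => ℕ) i 0 fun j => g j + 1

theorem embeddingSplit_inr_succAbove {k : ℕ} (i : Fin (k + 1)) (g : Fin k ↪ ℕ) (j : Fin k) :
    embeddingSplit (.inr (i, g)) (i.succAbove j) = g j + 1 :=
  Fin.insertNth_apply_succAbove (α := fun _ => ℕ) i 0 (fun j => g j + 1) j

theorem embeddingSplit_bijective {k : ℕ} : Function.Bijective (embeddingSplit (k := k)) := by
  have hl := embeddingSplit_inl (k := k)
  have h0 := embeddingSplit_inr_self (k := k)
  have h1 := embeddingSplit_inr_succAbove (k := k)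
  constructor
  · rintro (g | ⟨i, g⟩) (g' | ⟨i', g'⟩) h
    · congr 1
      ext j
      have := DFunLike.congr_fun h j
      simpa [hl] using this
    · have := DFunLike.congr_fun h i'
      simp [hl, h0] at this
    · have := DFunLike.congr_fun h i
      simp [hl, h0] at this
    · have hi : i = i' := (embeddingSplit (.inr (i, g))).injective (by rw [h0, h, h0])
      subst hi
      congr 2
      ext j
      have := DFunLike.congr_fun h (i.succAbove j)
      simpa [h1] using this
  · intro f
    by_cases hf : ∃ i, f i = 0
    · obtain ⟨i, hi⟩ := hf
      have hne : ∀ j, f (i.succAbove j) ≠ 0 := fun j hj =>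
        Fin.succAbove_ne i j (f.injective (hj.trans hi.symm))
      refine ⟨.inr (i, ⟨fun j => f (i.succAbove j) - 1, fun a b hab => ?_⟩), ?_⟩
      · have ha := hne a
        have hb := hne b
        exact i.succAbove_right_injective (f.injective (by simp only at hab; omega))
      · ext j
        rcases Fin.eq_self_or_eq_succAbove i j with rfl | ⟨j, rfl⟩
        · rw [h0, hi]
        · rw [h1]
          exact Nat.sub_add_cancel (Nat.one_le_iff_ne_zero.2 (hne j))
    · push Not at hf
      refine ⟨.inl ⟨fun j => f j - 1, fun a b hab => ?_⟩, ?_⟩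
      · have ha := hf a
        have hb := hf b
        exact f.injective (by simp only at hab; omega)
      · ext j
        exact Nat.sub_add_cancel (Nat.one_le_iff_ne_zero.2 (hf j))

/-- By distinctness at most one block uses index 0. Combined with the self-similarity of
stick-breaking, this gives the recursion behind the Ewens formula. -/
theorem distinctSum_succ {k : ℕ} (n : Fin (k + 1) → ℕ) (x : ℕ → ℝ≥0∞) :
    distinctSum n x = distinctSum n (fun j => x (j + 1)) +
      ∑ i, x 0 ^ n i * distinctSum (fun j => n (i.succAbove j)) fun j => x (j + 1) := by
  have h1 : distinctSum n x =
      ∑' s, ∏ i, x (embeddingSplit s i) ^ n i :=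
    ((Equiv.ofBijective _ embeddingSplit_bijective).tsum_eq fun f : Fin (k + 1) ↪ ℕ =>
      ∏ i, x (f i) ^ n i).symm
  have h2 : ∀ i, ∑' g : Fin k ↪ ℕ, ∏ j, x (embeddingSplit (.inr (i, g)) j) ^ n j =
      x 0 ^ n i * distinctSum (fun j => n (i.succAbove j)) fun j => x (j + 1) := by
    intro i
    rw [distinctSum, ← ENNReal.tsum_mul_left]
    refine tsum_congr fun g => ?_
    rw [Fin.prod_univ_succAbove _ i]
    simp_rw [embeddingSplit_inr_self, embeddingSplit_inr_succAbove]
  have h3 := Summable.tsum_sum (f := fun s => ∏ i, x (embeddingSplit s i) ^ n i)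
    ENNReal.summable ENNReal.summable
  have h4 := ENNReal.tsum_prod (f := fun i (g : Fin k ↪ ℕ) =>
    ∏ j, x (embeddingSplit (.inr (i, g)) j) ^ n j)
  simp_rw [h2, tsum_fintype] at h4
  refine h1.trans (h3.trans ?_)
  exact congrArg₂ (· + ·) rfl h4

/-! ### Moments of stick-breaking weights -/

/-- The integrand tilts the `Beta(1, c)` density to a multiple of the `Beta(1 + p, c + q)` density.
-/
theorem lintegral_betaMeasure {c : ℝ} (hc : 0 < c) (p q : ℕ) :
    ∫⁻ v, ENNReal.ofReal v ^ p * ENNReal.ofReal (1 - v) ^ q ∂(betaMeasure 1 c) =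
      ENNReal.ofReal (beta (1 + p) (c + q) / beta 1 c) := by
  have h1 := beta_pos one_pos hc
  have h2 := beta_pos (show (0 : ℝ) < 1 + p by positivity) (show 0 < c + q by positivity)
  rw [betaMeasure, lintegral_withDensity_eq_lintegral_mul _ (by unfold betaPDF; fun_prop)
    (by fun_prop)]
  have h : ∀ x : ℝ, betaPDF 1 c x * (ENNReal.ofReal x ^ p * ENNReal.ofReal (1 - x) ^ q) =
      ENNReal.ofReal (beta (1 + p) (c + q) / beta 1 c) * betaPDF (1 + p) (c + q) x := by
    intro x
    rcases le_or_gt x 0 with hx | hx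
    · simp [betaPDF_eq_zero_of_nonpos hx]
    rcases le_or_gt 1 x with hx' | hx'
    · simp [betaPDF_eq_zero_of_one_le hx']
    have h3 : 0 < 1 - x := by linarith
    have h4 := Real.rpow_pos_of_pos h3 (c - 1)
    rw [betaPDF_of_pos_lt_one hx hx', betaPDF_of_pos_lt_one hx hx', ← ENNReal.ofReal_pow hx.le,
      ← ENNReal.ofReal_pow h3.le, ← ENNReal.ofReal_mul (by positivity),
      ← ENNReal.ofReal_mul (by positivity), ← ENNReal.ofReal_mul (by positivity)]
    congr 1
    rw [show c + q - 1 = (c - 1) + q by ring, Real.rpow_add h3, Real.rpow_natCast,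
      show (1 : ℝ) + p - 1 = p by ring, Real.rpow_natCast, sub_self, Real.rpow_zero]
    field_simp
  simp only [Pi.mul_apply]
  rw [lintegral_congr h, lintegral_const_mul _ (by unfold betaPDF; fun_prop),
    lintegral_betaPDF_eq_one (by positivity) (by positivity), mul_one]

theorem ae_betaMeasure_mem (a b : ℝ) : ∀ᵐ v ∂(betaMeasure a b), 0 ≤ v ∧ v ≤ 1 := by
  rw [betaMeasure, ae_withDensity_iff (by unfold betaPDF; fun_prop)]
  refine ae_of_all _ fun v hv => ⟨?_, ?_⟩
  · by_contra h
    exact hv (betaPDF_eq_zero_of_nonpos (by linarith))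
  · by_contra h
    exact hv (betaPDF_eq_zero_of_one_le (by linarith))

/-- The stick-breaking weights with proportions `v`. -/
def stick (v : ℕ → ℝ) (k : ℕ) : ℝ :=
  v k * ∏ i ∈ Finset.range k, (1 - v i)

theorem measurable_stick : Measurable stick :=
  measurable_pi_lambda _ fun k => by unfold stick; fun_prop

theorem gem_eq_map_stick (c : ℝ) : gem c = (iid (betaMeasure 1 c)).map stick := rfl

theorem stick_seqCons_zero (p : ℝ × (ℕ → ℝ)) : stick (seqCons p) 0 = p.1 := by
  simp [stick, seqCons]

theorem stick_seqCons_succ (p : ℝ × (ℕ → ℝ)) (k : ℕ) :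
    stick (seqCons p) (k + 1) = (1 - p.1) * stick p.2 k := by
  simp only [stick, Finset.prod_range_succ', seqCons]
  ring

theorem isProbabilityMeasure_gem {c : ℝ} (hc : 0 < c) : IsProbabilityMeasure (gem c) := by
  have := isProbabilityMeasureBeta one_pos hc
  exact Measure.isProbabilityMeasure_map measurable_stick.aemeasurable

theorem sum_range_stick (v : ℕ → ℝ) (m : ℕ) :
    ∑ k ∈ Finset.range m, stick v k = 1 - ∏ i ∈ Finset.range m, (1 - v i) := by
  induction m with
  | zero => simp
  | succ m ih => rw [Finset.sum_range_succ, ih, Finset.prod_range_succ, stick]; ring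

theorem ae_iid {X : Type*} [MeasurableSpace X] {μ : Measure X} [IsProbabilityMeasure μ]
    {p : X → Prop} (h : ∀ᵐ x ∂μ, p x) : ∀ᵐ v ∂(iid μ), ∀ i, p (v i) := by
  rw [ae_all_iff]
  exact fun i => (measurePreserving_eval_infinitePi (fun _ : ℕ => μ) i).quasiMeasurePreserving.ae h

theorem ae_gem_tsum_le {c : ℝ} (hc : 0 < c) :
    ∀ᵐ w ∂(gem c), ∑' k, ENNReal.ofReal (w k) ≤ 1 := by
  have := isProbabilityMeasureBeta one_pos hc
  rw [gem_eq_map_stick, ae_map_iff measurable_stick.aemeasurable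
    (measurableSet_le (by fun_prop) measurable_const)]
  filter_upwards [ae_iid (ae_betaMeasure_mem 1 c)] with v hv
  rw [ENNReal.tsum_eq_iSup_nat]
  refine iSup_le fun m => ?_
  have h0 : ∀ m, 0 ≤ ∏ i ∈ Finset.range m, (1 - v i) := fun m =>
    Finset.prod_nonneg fun i _ => by linarith [(hv i).2]
  rw [← ENNReal.ofReal_sum_of_nonneg (f := stick v)
    fun i _ => mul_nonneg (hv i).1 (h0 i), sum_range_stick,
    ← ENNReal.ofReal_one]
  exact ENNReal.ofReal_le_ofReal (by linarith [h0 m])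

theorem measurable_distinctSum {k : ℕ} (n : Fin k → ℕ) : Measurable (distinctSum n) := by
  have : Countable (Fin k ↪ ℕ) :=
    (DFunLike.coe_injective : Function.Injective ((↑) : (Fin k ↪ ℕ) → Fin k → ℕ)).countable
  exact Measurable.tsum fun f => by fun_prop

/-- The Ewens sampling formula for blocks of sizes `n`. -/
def ewens (c : ℝ) {k : ℕ} (n : Fin k → ℕ) : ℝ :=
  c ^ k * (Real.Gamma c / Real.Gamma (c + (∑ i, n i : ℕ))) * ∏ i, Real.Gamma (n i)

/-- After the first stick `v`, the remaining weights are `1 - v` times an independent `GEM(c)`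
sequence. With `I` the integral and `S` the sum of the `n i`, splitting by the block that uses index
0 gives `I = c/(c+S) * I + ∑ i, n i/(c+S) * ewens c n`: by induction the term for block `i` is a
beta moment times the Ewens formula for the other blocks. -/
theorem lintegral_gem_distinctSum {c : ℝ} (hc : 0 < c) {k : ℕ} (n : Fin k → ℕ)
    (hn : ∀ i, 0 < n i) :
    ∫⁻ w, distinctSum n (fun j => ENNReal.ofReal (w j)) ∂(gem c) = ENNReal.ofReal (ewens c n) := by
  have := isProbabilityMeasureBeta one_pos hc
  have := isProbabilityMeasure_gem hc
  have hG := Real.Gamma_pos_of_pos hc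
  induction k with
  | zero => simp [distinctSum, ewens, hG.ne']
  | succ k ih =>
    have hmeas : ∀ {k : ℕ} (n : Fin k → ℕ),
        Measurable fun w : ℕ → ℝ => distinctSum n fun j => ENNReal.ofReal (w j) :=
      fun n => (measurable_distinctSum n).comp (by fun_prop)
    set I := ∫⁻ w, distinctSum n (fun j => ENNReal.ofReal (w j)) ∂(gem c) with hI
    -- Finiteness of `I` is what later permits cancelling its multiple from both sides.
    have hle : I ≤ 1 := by
      calc I ≤ ∫⁻ _, 1 ∂(gem c) := lintegral_mono_ae <| by
            filter_upwards [ae_gem_tsum_le hc] with w hw using distinctSum_le hn hw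
        _ = 1 := by simp
    set S := ∑ i, n i with hS
    have hrec : I = ENNReal.ofReal (beta (1 + (0 : ℕ)) (c + S) / beta 1 c) * I +
        ∑ i, ENNReal.ofReal (beta (1 + n i) (c + (∑ j, n (i.succAbove j) : ℕ)) / beta 1 c) *
          ENNReal.ofReal (ewens c fun j => n (i.succAbove j)) := by
      have h1 : I = ∫⁻ p : ℝ × (ℕ → ℝ), distinctSum n
          (fun j => ENNReal.ofReal (stick (seqCons p) j)) ∂((betaMeasure 1 c).prod
            (iid (betaMeasure 1 c))) := by
        rw [hI, gem_eq_map_stick, lintegral_map (hmeas n) measurable_stick]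
        conv_lhs => rw [← map_seqCons_iid]
        exact lintegral_map ((hmeas n).comp measurable_stick) measurable_seqCons
      have h2 : ∀ᵐ p : ℝ × (ℕ → ℝ) ∂((betaMeasure 1 c).prod (iid (betaMeasure 1 c))),
          distinctSum n (fun j => ENNReal.ofReal (stick (seqCons p) j)) =
          -- The factor of exponent 0 puts this term in the same form as the others, so that `h3`
          -- integrates all of them.
          ENNReal.ofReal p.1 ^ 0 * ENNReal.ofReal (1 - p.1) ^ S *
            distinctSum n (fun j => ENNReal.ofReal (stick p.2 j)) +
          ∑ i, ENNReal.ofReal p.1 ^ n i * ENNReal.ofReal (1 - p.1) ^ (∑ j, n (i.succAbove j)) *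
            distinctSum (fun j => n (i.succAbove j))
              (fun j => ENNReal.ofReal (stick p.2 j)) := by
        have := Measure.quasiMeasurePreserving_fst (μ := betaMeasure 1 c)
          (ν := iid (betaMeasure 1 c))
        filter_upwards [this.ae (ae_betaMeasure_mem 1 c)] with p hp
        rw [distinctSum_succ]
        simp_rw [stick_seqCons_zero, stick_seqCons_succ,
          ENNReal.ofReal_mul (sub_nonneg.2 hp.2), distinctSum_smul]
        simp [mul_assoc, hS]
      have h3 : ∀ {k : ℕ} (n : Fin k → ℕ) (p q : ℕ), ∫⁻ x : ℝ × (ℕ → ℝ),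
          ENNReal.ofReal x.1 ^ p * ENNReal.ofReal (1 - x.1) ^ q *
            distinctSum n (fun j => ENNReal.ofReal (stick x.2 j))
            ∂((betaMeasure 1 c).prod (iid (betaMeasure 1 c))) =
          ENNReal.ofReal (beta (1 + p) (c + q) / beta 1 c) *
            ∫⁻ w, distinctSum n (fun j => ENNReal.ofReal (w j)) ∂(gem c) := by
        intro k n p q
        rw [← lintegral_betaMeasure hc, gem_eq_map_stick,
          lintegral_map (hmeas n) measurable_stick]
        exact lintegral_prod_mul (f := fun v => ENNReal.ofReal v ^ p * ENNReal.ofReal (1 - v) ^ q)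
          (by fun_prop) ((hmeas n).comp measurable_stick).aemeasurable
      have h4 : ∀ {k : ℕ} (n : Fin k → ℕ), Measurable fun x : ℝ × (ℕ → ℝ) =>
          distinctSum n (fun j => ENNReal.ofReal (stick x.2 j)) := fun n =>
        ((hmeas n).comp measurable_stick).comp measurable_snd
      refine h1.trans ?_
      rw [lintegral_congr_ae h2, lintegral_add_left (by have := h4 n; fun_prop),
        lintegral_finsetSum _ fun i _ => by have := h4 (fun j => n (i.succAbove j)); fun_prop]
      simp_rw [h3]
      congr 1
      exact Finset.sum_congr rfl fun i _ => by rw [ih _ fun j => hn _]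
    have hSpos : (0 : ℝ) < S := by
      exact_mod_cast Finset.sum_pos (fun i _ => hn i) Finset.univ_nonempty
    have hGS := Real.Gamma_pos_of_pos (show 0 < c + S by positivity)
    have hG1 : Real.Gamma (1 + c) = c * Real.Gamma c := by
      rw [add_comm, Real.Gamma_add_one hc.ne']
    have hG2 : Real.Gamma (1 + (c + S)) = (c + S) * Real.Gamma (c + S) := by
      rw [add_comm, Real.Gamma_add_one (by positivity)]
    have hGn : ∀ i, 0 < Real.Gamma (n i) := fun i =>
      Real.Gamma_pos_of_pos (by exact_mod_cast hn i)
    have hbeta0 : beta (1 + (0 : ℕ)) (c + S) / beta 1 c = c / (c + S) := by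
      simp only [beta, Nat.cast_zero, add_zero, Real.Gamma_one, hG1, hG2]
      field_simp
    have hterm : ∀ i, ENNReal.ofReal
        (beta (1 + n i) (c + (∑ j, n (i.succAbove j) : ℕ)) / beta 1 c) *
          ENNReal.ofReal (ewens c fun j => n (i.succAbove j)) =
        ENNReal.ofReal (n i / (c + S) * ewens c n) := by
      intro i
      have e1 : n i + ∑ j, n (i.succAbove j) = S := (Fin.sum_univ_succAbove n i).symm
      set S' := ∑ j, n (i.succAbove j)
      have e2 : (S : ℝ) = n i + S' := by rw [← e1]; push_cast; rfl
      have hni : (0 : ℝ) < n i := by exact_mod_cast hn i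
      have hGS' := Real.Gamma_pos_of_pos (show 0 < c + S' by positivity)
      have hb1 := beta_pos (show (0 : ℝ) < 1 + n i by positivity) (show 0 < c + S' by positivity)
      have hb2 := beta_pos one_pos hc
      rw [← ENNReal.ofReal_mul (by positivity)]
      congr 1
      rw [ewens, ewens, Fin.prod_univ_succAbove _ i]
      simp only [beta, Real.Gamma_one, hG1]
      rw [show (1 : ℝ) + n i + (c + S') = 1 + (c + S) by rw [e2]; ring, hG2,
        add_comm 1 (n i : ℝ), Real.Gamma_add_one hni.ne']
      have := hGn i
      field_simp
      ring
    have hE : 0 ≤ ewens c n := by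
      have : 0 ≤ ∏ i, Real.Gamma (n i) := Finset.prod_nonneg fun i _ => (hGn i).le
      unfold ewens
      positivity
    have hb : ∑ i, ENNReal.ofReal
        (beta (1 + n i) (c + (∑ j, n (i.succAbove j) : ℕ)) / beta 1 c) *
          ENNReal.ofReal (ewens c fun j => n (i.succAbove j)) =
        ENNReal.ofReal (S / (c + S)) * ENNReal.ofReal (ewens c n) := by
      simp_rw [hterm]
      rw [← ENNReal.ofReal_sum_of_nonneg fun i _ => by positivity,
        ← ENNReal.ofReal_mul (by positivity), ← Finset.sum_mul, ← Finset.sum_div, hS]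
      push_cast
      rfl
    rw [hb, hbeta0] at hrec
    -- Split `I` on the left with these two coefficients, cancel `c/(c+S) * I`, then divide by
    -- `S/(c+S)`.
    have hone : ENNReal.ofReal (c / (c + S)) + ENNReal.ofReal (S / (c + S)) = 1 := by
      rw [← ENNReal.ofReal_add (by positivity) (by positivity), ← add_div,
        div_self (by positivity), ENNReal.ofReal_one]
    have hfin : ENNReal.ofReal (c / (c + S)) * I ≠ ∞ :=
      ENNReal.mul_ne_top ENNReal.ofReal_ne_top (hle.trans_lt ENNReal.one_lt_top).ne
    have hrec' : ENNReal.ofReal (c / (c + S)) * I + ENNReal.ofReal (S / (c + S)) * I =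
        ENNReal.ofReal (c / (c + S)) * I +
          ENNReal.ofReal (S / (c + S)) * ENNReal.ofReal (ewens c n) := by
      rw [← add_mul, hone, one_mul]; exact hrec
    have h5 := (ENNReal.add_right_inj hfin).1 hrec'
    refine (ENNReal.mul_right_inj ?_ ENNReal.ofReal_ne_top).1 h5
    rw [ne_eq, ENNReal.ofReal_eq_zero, not_le]
    positivity

/-- The total mass is almost surely at most 1, and its expectation is the Ewens formula for a single
block of size 1, which equals 1. -/
theorem ae_gem_tsum_eq {c : ℝ} (hc : 0 < c) :
    ∀ᵐ w ∂(gem c), ∑' k, ENNReal.ofReal (w k) = 1 := by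
  have := isProbabilityMeasure_gem hc
  have h := lintegral_gem_distinctSum hc (k := 1) (fun _ => 1) (by simp)
  have h1 : ewens c (k := 1) (fun _ => 1) = 1 := by
    have := Real.Gamma_pos_of_pos hc
    simp [ewens, Real.Gamma_add_one hc.ne']
    field_simp
  have h2 : ∀ x : ℕ → ℝ≥0∞, distinctSum (k := 1) (fun _ => 1) x = ∑' j, x j := fun x => by
    rw [distinctSum, ← (Function.Embedding.oneEmbeddingEquiv).symm.tsum_eq]
    simp
    rfl
  rw [h1, ENNReal.ofReal_one] at h
  simp_rw [h2] at h
  have h3 := ae_eq_of_ae_le_of_lintegral_le (ae_gem_tsum_le hc) (by rw [h]; simp)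
    aemeasurable_const (by rw [h]; simp)
  exact h3

/-! ### Symmetric Dirichlet weights -/

/-- Extend a finite weight vector by zeros. -/
def zeroExtend (n : ℕ) (w : Fin n → ℝ) (k : ℕ) : ℝ := if h : k < n then w ⟨k, h⟩ else 0

theorem measurable_zeroExtend (n : ℕ) : Measurable (zeroExtend n) := by
  refine measurable_pi_lambda _ fun k => ?_
  unfold zeroExtend
  split_ifs <;> fun_prop

theorem symDirichlet_eq_map (c : ℝ) (n : ℕ) :
    symDirichlet c n = (dirichlet fun _ : Fin n => c / n).map (zeroExtend n) := rfl

theorem symDirichlet_shape_pos {c : ℝ} (hc : 0 < c) {n : ℕ} (_ : Fin n) : 0 < c / n := by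
  have : 0 < n := Fin.pos ‹_›
  positivity

theorem isProbabilityMeasure_symDirichlet {c : ℝ} (hc : 0 < c) (n : ℕ) :
    IsProbabilityMeasure (symDirichlet c n) := by
  have := isProbabilityMeasure_dirichlet (n := n) (a := fun _ => c / n) (symDirichlet_shape_pos hc)
  exact Measure.isProbabilityMeasure_map (measurable_zeroExtend n).aemeasurable

theorem ae_symDirichlet_tsum_eq {c : ℝ} (hc : 0 < c) {n : ℕ} (hn : 0 < n) :
    ∀ᵐ w ∂(symDirichlet c n), ∑' k, ENNReal.ofReal (w k) = 1 := by
  rw [symDirichlet_eq_map, ae_map_iff (measurable_zeroExtend n).aemeasurable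
    (measurableSet_eq_fun (by fun_prop) measurable_const)]
  filter_upwards [ae_dirichlet hn (a := fun _ => c / n) (symDirichlet_shape_pos hc)] with w hw
  have h : ∀ k ∉ Finset.range n, ENNReal.ofReal (zeroExtend n w k) = 0 := fun k hk => by
    simp [zeroExtend, Finset.mem_range.not.1 hk]
  rw [tsum_eq_sum h, Finset.sum_range, ← ENNReal.ofReal_one, ← hw.2, ENNReal.ofReal_sum_of_nonneg
    fun i _ => (hw.1 i).le]
  exact Finset.sum_congr rfl fun i _ => by simp [zeroExtend]

theorem ae_symDirichlet_eq_zero (c : ℝ) (n : ℕ) :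
    ∀ᵐ w ∂(symDirichlet c n), ∀ k, n ≤ k → w k = 0 := by
  have hS : MeasurableSet {w : ℕ → ℝ | ∀ k, n ≤ k → w k = 0} := by
    have : {w : ℕ → ℝ | ∀ k, n ≤ k → w k = 0} = ⋂ k, ⋂ _ : n ≤ k, {w | w k = 0} := by ext; simp
    rw [this]
    exact .iInter fun k => .iInter fun _ => measurableSet_eq_fun (by fun_prop) measurable_const
  rw [symDirichlet_eq_map, ae_map_iff (measurable_zeroExtend n).aemeasurable hS]
  exact ae_of_all _ fun w k hk => by simp [zeroExtend, not_lt.2 hk]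

theorem lintegral_symDirichlet_distinctSum {c : ℝ} (hc : 0 < c) {K : ℕ} (hK : 0 < K) {k : ℕ}
    (n : Fin k → ℕ) (hn : ∀ i, 0 < n i) :
    ∫⁻ w, distinctSum n (fun j => ENNReal.ofReal (w j)) ∂(symDirichlet c K) =
      ENNReal.ofReal (K.descFactorial k * (Real.Gamma c / Real.Gamma (c + (∑ i, n i : ℕ)) *
        ∏ i, Real.Gamma (c / K + n i) / Real.Gamma (c / K))) := by
  have hcK : 0 < c / K := by positivity
  have hG := Real.Gamma_pos_of_pos hcK
  have hm : Measurable fun w : ℕ → ℝ => distinctSum n fun j => ENNReal.ofReal (w j) :=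
    (measurable_distinctSum n).comp (by fun_prop)
  rw [symDirichlet_eq_map, lintegral_map hm (measurable_zeroExtend K)]
  have h1 : ∀ w : Fin K → ℝ, distinctSum n (fun j => ENNReal.ofReal (zeroExtend K w j)) =
      ∑ f : Fin k ↪ Fin K, ∏ i, ENNReal.ofReal (w (f i)) ^ n i := by
    intro w
    have hinj : Function.Injective fun f : Fin k ↪ Fin K => f.trans Fin.valEmbedding := by
      intro f g h
      ext i
      exact DFunLike.congr_fun h i
    rw [distinctSum, ← hinj.tsum_eq, tsum_fintype]
    · refine Finset.sum_congr rfl fun f _ => Finset.prod_congr rfl fun i _ => ?_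
      simp [zeroExtend]
    -- A term that uses an index from `K` on vanishes, because a zero weight occurs there with
    -- positive exponent.
    · intro f hf
      have hlt : ∀ i, f i < K := by
        intro i
        by_contra h
        refine hf (Finset.prod_eq_zero (Finset.mem_univ i) ?_)
        simp [zeroExtend, h, (hn i).ne']
      exact ⟨⟨fun i => ⟨f i, hlt i⟩, fun a b h => f.injective (by simpa using h)⟩, by ext; rfl⟩
  have h2 : ∀ f : Fin k ↪ Fin K,
      ∫⁻ w, ∏ i, ENNReal.ofReal (w (f i)) ^ n i ∂(dirichlet fun _ : Fin K => c / K) =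
        ENNReal.ofReal (Real.Gamma c / Real.Gamma (c + (∑ i, n i : ℕ)) *
          ∏ i, Real.Gamma (c / K + n i) / Real.Gamma (c / K)) := by
    intro f
    -- The exponents are extended by zero to all `K` coordinates; the unused coordinates contribute
    -- factors 1 to the Dirichlet moment.
    have e1 : ∀ i, Function.extend f n (0 : Fin K → ℕ) (f i) = n i :=
      fun i => f.injective.extend_apply n _ i
    have e2 : ∀ j, j ∉ Set.range f → Function.extend f n (0 : Fin K → ℕ) j = 0 := fun j hj =>
      Function.extend_apply' n _ j hj
    have h3 := lintegral_dirichlet hK (a := fun _ : Fin K => c / K) (fun _ => hcK)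
      (Function.extend f n 0)
    have hw : ∀ w : Fin K → ℝ, ∏ j, ENNReal.ofReal (w j) ^ Function.extend f n 0 j =
        ∏ i, ENNReal.ofReal (w (f i)) ^ n i := fun w =>
      (Fintype.prod_of_injective f f.injective _ _ (fun j hj => by rw [e2 j hj, pow_zero])
        fun i => by rw [e1]).symm
    have hs : ∑ j, Function.extend f n 0 j = ∑ i, n i :=
      (Fintype.sum_of_injective f f.injective _ _ (fun j hj => e2 j hj) fun i => (e1 i).symm).symm
    have hp : ∏ j, ENNReal.ofReal (Real.Gamma (c / K + Function.extend f n 0 j) /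
          Real.Gamma (c / K)) =
        ∏ i, ENNReal.ofReal (Real.Gamma (c / K + n i) / Real.Gamma (c / K)) :=
      (Fintype.prod_of_injective f f.injective _ _
        (fun j hj => by rw [e2 j hj]; simp [div_self hG.ne']) fun i => by rw [e1]).symm
    have hc' : ∑ _j : Fin K, c / K = c := by
      simp only [Finset.sum_const, Finset.card_univ, Fintype.card_fin, nsmul_eq_mul]
      field_simp
    simp_rw [hw, hp, hs, hc'] at h3
    rw [h3, ENNReal.ofReal_mul, ENNReal.ofReal_prod_of_nonneg]
    · intro i _
      have := Real.Gamma_pos_of_pos (show 0 < c / K + n i by positivity)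
      positivity
    · have := Real.Gamma_pos_of_pos hc
      have := Real.Gamma_pos_of_pos (show 0 < c + (∑ i, n i : ℕ) by positivity)
      positivity
  simp_rw [h1]
  rw [lintegral_finsetSum _ fun f _ => by fun_prop]
  simp_rw [h2]
  rw [Finset.sum_const, Finset.card_univ, Fintype.card_embedding_eq, Fintype.card_fin,
    Fintype.card_fin, nsmul_eq_mul,
    ENNReal.ofReal_mul (p := (K.descFactorial k : ℝ)) (by positivity), ENNReal.ofReal_natCast]

theorem tendsto_descFactorial_div_pow (k : ℕ) :
    Tendsto (fun K : ℕ => (K.descFactorial k : ℝ) / (K : ℝ) ^ k) atTop (𝓝 1) := by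
  have h : ∀ i : ℕ, Tendsto (fun K : ℕ => ((K - i : ℕ) : ℝ) / K) atTop (𝓝 1) := by
    intro i
    have h1 : Tendsto (fun K : ℕ => 1 - (i : ℝ) / K) atTop (𝓝 (1 - 0)) :=
      tendsto_const_nhds.sub (tendsto_const_div_atTop_nhds_zero_nat (i : ℝ))
    rw [sub_zero] at h1
    refine h1.congr' ?_
    filter_upwards [eventually_ge_atTop (i + 1)] with K hK
    have : (0 : ℝ) < K := by exact_mod_cast (by omega : 0 < K)
    rw [Nat.cast_sub (by omega)]
    field_simp
  have h2 := tendsto_finsetProd (Finset.range k) fun i _ => h i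
  simp only [Finset.prod_const_one] at h2
  refine h2.congr fun K => ?_
  rw [Nat.descFactorial_eq_prod_range, Finset.prod_div_distrib]
  simp

theorem tendsto_lintegral_symDirichlet_distinctSum {c : ℝ} (hc : 0 < c) {k : ℕ}
    (n : Fin k → ℕ) (hn : ∀ i, 0 < n i) :
    Tendsto (fun K => ∫⁻ w, distinctSum n (fun j => ENNReal.ofReal (w j)) ∂(symDirichlet c K))
      atTop (𝓝 (∫⁻ w, distinctSum n (fun j => ENNReal.ofReal (w j)) ∂(gem c))) := by
  rw [lintegral_gem_distinctSum hc n hn]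
  have h0 : Tendsto (fun K : ℕ => c / (K : ℝ)) atTop (𝓝 0) :=
    tendsto_const_div_atTop_nhds_zero_nat c
  have hcont : ∀ s : ℝ, 0 < s →
      Tendsto (fun K : ℕ => Real.Gamma (c / K + s)) atTop (𝓝 (Real.Gamma s)) := by
    intro s hs
    have h1 : Tendsto (fun K : ℕ => c / K + s) atTop (𝓝 s) := by
      simpa using h0.add_const s
    refine ((Real.differentiableAt_Gamma fun m => ?_).continuousAt.tendsto).comp h1
    have : (0 : ℝ) ≤ m := by positivity
    linarith
  -- The pole of `Γ` at 0 is removed by `Γ(c/K) = (K/c) * Γ(c/K + 1)`. Each block then carries a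
  -- factor `1/K`, and these `k` factors are balanced by the descending factorial of `K`.
  have h1 : ∀ i, Tendsto (fun K : ℕ => c * (Real.Gamma (c / K + n i) / Real.Gamma (c / K + 1)))
      atTop (𝓝 (c * Real.Gamma (n i))) := by
    intro i
    have := (hcont (n i) (by exact_mod_cast hn i)).div (hcont 1 one_pos) (by simp)
    simpa using this.const_mul c
  have h2 := (tendsto_descFactorial_div_pow k).mul
    ((tendsto_finsetProd Finset.univ fun i _ => h1 i).const_mul
      (Real.Gamma c / Real.Gamma (c + (∑ i, n i : ℕ))))
  have h3 : 1 * (Real.Gamma c / Real.Gamma (c + (∑ i, n i : ℕ)) * ∏ i, (c * Real.Gamma (n i))) =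
      ewens c n := by
    rw [ewens, Finset.prod_mul_distrib]
    simp
    ring
  rw [h3] at h2
  refine ((ENNReal.continuous_ofReal.tendsto _).comp h2).congr' ?_
  filter_upwards [eventually_gt_atTop 0] with K hK
  rw [lintegral_symDirichlet_distinctSum hc hK n hn, Function.comp_apply]
  congr 1
  have hK' : (0 : ℝ) < K := by exact_mod_cast hK
  have hcK : 0 < c / K := by positivity
  have h4 : ∀ i, Real.Gamma (c / K + n i) / Real.Gamma (c / K) =
      (1 / K) * (c * (Real.Gamma (c / K + n i) / Real.Gamma (c / K + 1))) := by
    intro i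
    have := Real.Gamma_pos_of_pos hcK
    rw [Real.Gamma_add_one hcK.ne']
    field_simp
  simp_rw [h4]
  rw [Finset.prod_mul_distrib (f := fun _ => (1 / K : ℝ))]
  simp
  field_simp

/-! ### Exchangeable partition probabilities -/

instance {D : Type*} [Finite D] : Finite (Setoid D) :=
  Finite.of_injective (fun S : Setoid D => S.r) fun _ _ h => Setoid.ext fun a b =>
    iff_of_eq (congrFun (congrFun h a) b)

instance {D : Type*} [Finite D] : Fintype (Setoid D) := Fintype.ofFinite _

/-- The sum of `∏ c, x (t c)` over all labellings `t` whose level sets are the blocks of `V`. -/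
def partitionSum {D : Type*} [Fintype D] (V : Setoid D) (x : ℕ → ℝ≥0∞) : ℝ≥0∞ :=
  ∑' t : D → ℕ, if Setoid.ker t = V then ∏ c, x (t c) else 0

theorem measurable_partitionSum {D : Type*} [Fintype D] (V : Setoid D) :
    Measurable (partitionSum V) := by
  refine Measurable.tsum fun t => ?_
  split_ifs <;> fun_prop

/-- A labelling with kernel `V` is an injective labelling of the blocks of `V`; the exponents are
the block sizes. -/
theorem partitionSum_eq_distinctSum {D : Type*} [Fintype D] (V : Setoid D) :
    ∃ (k : ℕ) (n : Fin k → ℕ), (∀ i, 0 < n i) ∧ ∀ x, partitionSum V x = distinctSum n x := by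
  let e := Fintype.equivFin (Quotient V)
  refine ⟨_, fun i => Finset.card {c | e ⟦c⟧ = i}, fun i => ?_, fun x => ?_⟩
  · obtain ⟨c, hc⟩ := Quotient.exists_rep (e.symm i)
    exact Finset.card_pos.2 ⟨c, by simp [hc]⟩
  · let φ : (Fin (Fintype.card (Quotient V)) ↪ ℕ) → D → ℕ := fun f c => f (e ⟦c⟧)
    have hφ : Function.Injective φ := by
      intro f g h
      ext i
      obtain ⟨c, hc⟩ := Quotient.exists_rep (e.symm i)
      simpa [φ, hc] using congrFun h c
    rw [partitionSum, distinctSum, ← hφ.tsum_eq]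
    · refine tsum_congr fun f => ?_
      have hker : Setoid.ker (φ f) = V := by
        ext a b
        rw [Setoid.ker_def]
        simp [φ, Quotient.eq]
      rw [if_pos hker]
      simp_rw [← Finset.prod_const]
      exact (Finset.prod_fiberwise' Finset.univ (fun c => e ⟦c⟧) fun i => x (f i)).symm
    · intro t ht
      have hker : Setoid.ker t = V := by
        by_contra h
        simp [h] at ht
      have hlift : ∀ a b, V a b → t a = t b := fun a b h => by rwa [← hker] at h
      refine ⟨⟨fun i => Quotient.lift t hlift (e.symm i), fun i j h => ?_⟩, ?_⟩
      · apply e.symm.injective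
        revert h
        dsimp only
        induction e.symm i using Quotient.inductionOn
        induction e.symm j using Quotient.inductionOn
        intro h
        rw [Quotient.eq, ← hker]
        exact h
      · ext c
        change Quotient.lift t hlift (e.symm (e ⟦c⟧)) = t c
        simp

/-- The probability that independent draws from random weights with law `W` coincide exactly as
prescribed by the partition `V`. -/
def partitionProb {D : Type*} [Fintype D] (W : Measure (ℕ → ℝ)) (V : Setoid D) : ℝ≥0∞ :=
  ∫⁻ w, partitionSum V (fun j => ENNReal.ofReal (w j)) ∂W

theorem tendsto_partitionProb {D : Type*} [Fintype D] {c : ℝ} (hc : 0 < c) (V : Setoid D) :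
    Tendsto (fun K => partitionProb (symDirichlet c K) V) atTop (𝓝 (partitionProb (gem c) V)) := by
  obtain ⟨k, n, hn, h⟩ := partitionSum_eq_distinctSum V
  simp_rw [partitionProb, h]
  exact tendsto_lintegral_symDirichlet_distinctSum hc n hn

theorem partitionProb_gem_ne_top {D : Type*} [Fintype D] {c : ℝ} (hc : 0 < c) (V : Setoid D) :
    partitionProb (gem c) V ≠ ∞ := by
  obtain ⟨k, n, hn, h⟩ := partitionSum_eq_distinctSum V
  simp_rw [partitionProb, h]
  rw [lintegral_gem_distinctSum hc n hn]
  exact ENNReal.ofReal_ne_top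

/-! ### Measurability of random product measures -/

/-- It suffices to test on the π-system of cylinders, where the product measure is a finite product.
-/
theorem measurable_infinitePi {A ι : Type*} [MeasurableSpace A] {X : ι → Type*}
    [∀ i, MeasurableSpace (X i)] (κ : A → (i : ι) → Measure (X i))
    [∀ a i, IsProbabilityMeasure (κ a i)] (hκ : ∀ i, Measurable fun a => κ a i) :
    Measurable fun a => Measure.infinitePi (κ a) := by
  refine Measurable.measure_of_isPiSystem_of_isProbabilityMeasure
    generateFrom_squareCylinders.symm
    (isPiSystem_squareCylinders (fun _ => MeasurableSpace.isPiSystem_measurableSet)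
      fun _ => MeasurableSet.univ) ?_
  rintro _ ⟨s, t, ht, rfl⟩
  have ht' : ∀ i, MeasurableSet (t i) := fun i => ht i trivial
  simp_rw [Measure.infinitePi_pi _ fun i _ => ht' i]
  exact Finset.measurable_prod _ fun i _ => (Measure.measurable_coe (ht' i)).comp (hκ i)

theorem measurable_measure_pi {A ι : Type*} [MeasurableSpace A] [Fintype ι] {X : ι → Type*}
    [∀ i, MeasurableSpace (X i)] (κ : A → (i : ι) → Measure (X i))
    [∀ a i, IsProbabilityMeasure (κ a i)] (hκ : ∀ i, Measurable fun a => κ a i) :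
    Measurable fun a => Measure.pi (κ a) := by
  simp_rw [← Measure.infinitePi_eq_pi]
  exact measurable_infinitePi κ hκ

theorem measurable_const_prod {A X Y : Type*} [MeasurableSpace A] [MeasurableSpace X]
    [MeasurableSpace Y] (μ : Measure X) [IsProbabilityMeasure μ] (ν : A → Measure Y)
    [∀ a, IsProbabilityMeasure (ν a)] (hν : Measurable ν) : Measurable fun a => μ.prod (ν a) := by
  let κ : Kernel A Y := ⟨ν, hν⟩
  have : IsMarkovKernel κ := ⟨fun a => inferInstanceAs (IsProbabilityMeasure (ν a))⟩
  have h := (Kernel.const A μ ×ₖ κ).measurable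
  have h1 : ∀ a, (Kernel.const A μ ×ₖ κ) a = μ.prod (ν a) := fun a => by
    rw [Kernel.prod_apply]; rfl
  simpa only [← h1] using h

/-! ### Discrete random measures -/

section Atomic
variable {X : Type*} [MeasurableSpace X]

theorem atomic_apply (w : ℕ → ℝ) (φ : ℕ → X) {s : Set X} (hs : MeasurableSet s) :
    atomic w φ s = ∑' k, ENNReal.ofReal (w k) * s.indicator 1 (φ k) := by
  simp [atomic, Measure.sum_apply _ hs, Measure.dirac_apply' _ hs]

theorem measurable_atomic : Measurable fun p : (ℕ → ℝ) × (ℕ → X) => atomic p.1 p.2 := by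
  refine Measure.measurable_of_measurable_coe _ fun s hs => ?_
  simp_rw [atomic_apply _ _ hs]
  refine Measurable.tsum fun k => Measurable.mul (by fun_prop) ?_
  exact (measurable_one.indicator hs).comp ((measurable_pi_apply k).comp measurable_snd)

theorem map_categorical (w : ℕ → ℝ) (φ : ℕ → ℕ) : (categorical w).map φ = atomic w φ := by
  ext s hs
  rw [Measure.map_apply measurable_from_top hs, categorical,
    atomic_apply _ _ (.of_discrete), atomic_apply _ _ hs]
  rfl

theorem categorical_singleton (w : ℕ → ℝ) (k : ℕ) : categorical w {k} = ENNReal.ofReal (w k) := by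
  rw [categorical, atomic_apply _ _ (measurableSet_singleton k), tsum_eq_single k]
  · simp
  · intro j hj; simp [hj]

theorem isProbabilityMeasure_categorical {w : ℕ → ℝ} (hw : ∑' k, ENNReal.ofReal (w k) = 1) :
    IsProbabilityMeasure (categorical w) := by
  constructor
  rw [categorical, atomic_apply _ _ .univ]
  simpa using hw

theorem measurable_categorical : Measurable categorical :=
  measurable_atomic.comp (f := fun w : ℕ → ℝ => (w, (id : ℕ → ℕ)))
    (measurable_id.prodMk measurable_const)

end Atomic

/-! ### Restaurants -/

/-- The law of the dish distribution of a restaurant with table weights of law `W`, whose tables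
serve independent dishes of law `β`. -/
def restaurantLaw (W : Measure (ℕ → ℝ)) (β : Measure ℕ) : Measure (Measure ℕ) :=
  (W.prod (iid β)).map fun p => atomic p.1 p.2

theorem tableRestaurant_eq (c : ℝ) (n : ℕ) (β : Measure ℕ) :
    tableRestaurant c n β = restaurantLaw (symDirichlet c n) β := by
  simp_rw [tableRestaurant, restaurantLaw, map_categorical]

instance (W : Measure (ℕ → ℝ)) [IsProbabilityMeasure W] (β : Measure ℕ) [IsProbabilityMeasure β] :
    IsProbabilityMeasure (restaurantLaw W β) :=
  Measure.isProbabilityMeasure_map measurable_atomic.aemeasurable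

/-- The law of the dish distributions of a level with dish weights of law `B` and table weights of
law `W r` in restaurant `r`. -/
def levelLaw (B : Measure (ℕ → ℝ)) (W : ℕ → Measure (ℕ → ℝ)) : Measure (ℕ → Measure ℕ) :=
  B.bind fun b => Measure.infinitePi fun r => restaurantLaw (W r) (categorical b)

theorem finiteLevel_eq (γ α : ℝ) (K : ℕ) (T : ℕ → ℕ) :
    finiteLevel γ α K T = levelLaw (symDirichlet γ K) fun r => symDirichlet α (T r) := by
  simp_rw [finiteLevel, levelLaw, tableRestaurant_eq]

/-- Integration against `bind` requires this. The dish weights are probability weights only almost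
surely, so elsewhere they are replaced by a point mass at dish 0. -/
theorem aemeasurable_infinitePi_restaurantLaw {B : Measure (ℕ → ℝ)}
    (hB : ∀ᵐ b ∂B, ∑' k, ENNReal.ofReal (b k) = 1) (W : ℕ → Measure (ℕ → ℝ))
    [∀ r, IsProbabilityMeasure (W r)] :
    AEMeasurable (fun b => Measure.infinitePi fun r => restaurantLaw (W r) (categorical b)) B := by
  have hS : MeasurableSet {b : ℕ → ℝ | ∑' k, ENNReal.ofReal (b k) = 1} :=
    measurableSet_eq_fun (by fun_prop) measurable_const
  let g : (ℕ → ℝ) → ℕ → ℝ := fun b => if ∑' k, ENNReal.ofReal (b k) = 1 then b else Pi.single 0 1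
  have hg : Measurable g := Measurable.ite hS measurable_id measurable_const
  have hg1 : ∀ b, ∑' k, ENNReal.ofReal (g b k) = 1 := by
    intro b
    by_cases h : ∑' k, ENNReal.ofReal (b k) = 1
    · simp only [g, if_pos h, h]
    · simp only [g, if_neg h]
      rw [tsum_eq_single 0 fun k hk => by simp [hk]]
      simp
  have hp : ∀ b, IsProbabilityMeasure (categorical (g b)) := fun b =>
    isProbabilityMeasure_categorical (hg1 b)
  have hiid : Measurable fun b => iid (categorical (g b)) :=
    measurable_infinitePi (fun b (_ : ℕ) => categorical (g b)) fun _ =>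
      measurable_categorical.comp hg
  refine ⟨fun b => Measure.infinitePi fun r => restaurantLaw (W r) (categorical (g b)),
    measurable_infinitePi (fun b r => restaurantLaw (W r) (categorical (g b))) fun r =>
      (Measure.measurable_map _ measurable_atomic).comp (measurable_const_prod (W r) _ hiid), ?_⟩
  filter_upwards [hB] with b hb
  simp only [g, if_pos hb]

theorem lintegral_levelLaw {B : Measure (ℕ → ℝ)}
    (hB : ∀ᵐ b ∂B, ∑' k, ENNReal.ofReal (b k) = 1) (W : ℕ → Measure (ℕ → ℝ))
    [∀ r, IsProbabilityMeasure (W r)] {f : (ℕ → Measure ℕ) → ℝ≥0∞} (hf : Measurable f) :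
    ∫⁻ G, f G ∂(levelLaw B W) = ∫⁻ b, ∫⁻ G, f G
      ∂(Measure.infinitePi fun r => restaurantLaw (W r) (categorical b)) ∂B :=
  Measure.lintegral_bind (aemeasurable_infinitePi_restaurantLaw hB W) hf.aemeasurable

theorem isProbabilityMeasure_levelLaw {B : Measure (ℕ → ℝ)} [IsProbabilityMeasure B]
    (hB : ∀ᵐ b ∂B, ∑' k, ENNReal.ofReal (b k) = 1) (W : ℕ → Measure (ℕ → ℝ))
    [∀ r, IsProbabilityMeasure (W r)] : IsProbabilityMeasure (levelLaw B W) := by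
  constructor
  rw [← lintegral_one, lintegral_levelLaw hB W measurable_const]
  have : ∀ᵐ b ∂B, ∫⁻ _, 1 ∂(Measure.infinitePi fun r => restaurantLaw (W r) (categorical b)) =
      1 := by
    filter_upwards [hB] with b hb
    have := isProbabilityMeasure_categorical hb
    simp
  rw [lintegral_congr_ae this]
  simp

/-! ### Independent labels along a labelling -/

theorem map_iid_comp_injective {X Q : Type*} [MeasurableSpace X] [Fintype Q] (μ : Measure X)
    [IsProbabilityMeasure μ] {f : Q → ℕ} (hf : Function.Injective f) :
    (iid μ).map (fun φ q => φ (f q)) = Measure.pi fun _ : Q => μ := by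
  have h1 : iIndepFun (fun i (ω : ℕ → X) => ω i) (iid μ) :=
    iIndepFun_infinitePi (X := fun _ x => x) fun _ => measurable_id
  have h2 := (iIndepFun_iff_map_fun_eq_pi_map fun q => (measurable_pi_apply _).aemeasurable).1
    (h1.precomp hf)
  rw [h2]
  congr 1
  ext1 q
  exact Measure.infinitePi_map_eval (fun _ : ℕ => μ) (f q)

/-- The law of independent labels along a labelling `t` only depends on the partition that `t`
induces. -/
theorem map_iid_comp {X D : Type*} [MeasurableSpace X] [Fintype D] (μ : Measure X)
    [IsProbabilityMeasure μ] (t : D → ℕ) :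
    (iid μ).map (fun φ c => φ (t c)) =
      (Measure.pi fun _ : Quotient (Setoid.ker t) => μ).map fun ψ c => ψ (Quotient.mk (Setoid.ker t) c) := by
  rw [← map_iid_comp_injective μ (Setoid.kerLift_injective t)]
  exact (Measure.map_map (μ := iid μ)
    (g := fun (ψ : Quotient (Setoid.ker t) → X) (c : D) => ψ (Quotient.mk (Setoid.ker t) c))
    (f := fun (φ : ℕ → X) q => φ (Setoid.kerLift t q))
    (measurable_pi_lambda _ fun _ => measurable_pi_apply _)
    (measurable_pi_lambda _ fun _ => measurable_pi_apply _)).symm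

/-- The probability that independent labels with weights `x` on the blocks of `V` produce the
labelling `k`. -/
def blockProb {D : Type*} [Fintype D] (x : ℕ → ℝ≥0∞) (V : Setoid D) (k : D → ℕ) : ℝ≥0∞ :=
  ∑' κ : Quotient V → ℕ, if (fun c => κ (Quotient.mk V c)) = k then ∏ B, x (κ B) else 0

theorem iid_comp_eq {D : Type*} [Fintype D] (β : Measure ℕ) [IsProbabilityMeasure β]
    (t k : D → ℕ) :
    iid β {φ | ∀ c, φ (t c) = k c} = blockProb (fun j => β {j}) (Setoid.ker t) k := by
  have h := congrArg (fun μ : Measure (D → ℕ) => μ {k}) (map_iid_comp β t)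
  have hm : MeasurableSet ({k} : Set (D → ℕ)) := measurableSet_singleton k
  rw [Measure.map_apply (measurable_pi_lambda _ fun _ => measurable_pi_apply _) hm,
    Measure.map_apply (measurable_pi_lambda _ fun _ => measurable_pi_apply _) hm] at h
  have h1 : {φ : ℕ → ℕ | ∀ c, φ (t c) = k c} = (fun φ c => φ (t c)) ⁻¹' {k} := by
    ext φ; simp [funext_iff]
  rw [h1, h, ← lintegral_indicator_one (.of_discrete), lintegral_countable', blockProb]
  refine tsum_congr fun κ => ?_
  by_cases hκ : (fun c => κ (Quotient.mk (Setoid.ker t) c)) = k <;> simp [Set.indicator, hκ, Measure.pi_singleton]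

/-- Expanding the product of atomic sums gives a sum over table assignments `t`. Weights and dishes
of the tables are independent, and the dish factor depends only on the kernel of `t`; grouping by
kernels separates the seating from the choice of dishes. -/
theorem lintegral_restaurantLaw {D : Type*} [Fintype D] (W : Measure (ℕ → ℝ))
    [IsProbabilityMeasure W] (β : Measure ℕ) [IsProbabilityMeasure β] (k : D → ℕ) :
    ∫⁻ G, ∏ c, G {k c} ∂(restaurantLaw W β) =
      ∑ V : Setoid D, partitionProb W V * blockProb (fun j => β {j}) V k := by
  have hG : Measurable fun G : Measure ℕ => ∏ c, G {k c} :=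
    Finset.measurable_prod _ fun c _ => Measure.measurable_coe (measurableSet_singleton _)
  have h1 : ∀ p : (ℕ → ℝ) × (ℕ → ℕ), ∏ c, atomic p.1 p.2 {k c} =
      ∑' t : D → ℕ, (∏ c, ENNReal.ofReal (p.1 (t c))) *
        Set.indicator {φ | ∀ c, φ (t c) = k c} 1 p.2 := by
    intro p
    simp_rw [atomic_apply _ _ (measurableSet_singleton _)]
    rw [← tsum_pi_prod fun c j => ENNReal.ofReal (p.1 j) * Set.indicator {k c} 1 (p.2 j)]
    refine tsum_congr fun t => ?_
    rw [Finset.prod_mul_distrib]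
    congr 1
    by_cases h : ∀ c, p.2 (t c) = k c
    · simp [Set.indicator, h]
    · rw [Set.indicator_of_notMem (by exact h)]
      push Not at h
      obtain ⟨c, hc⟩ := h
      exact Finset.prod_eq_zero (Finset.mem_univ c) (by simp [hc])
  have hms : ∀ t : D → ℕ, MeasurableSet {φ : ℕ → ℕ | ∀ c, φ (t c) = k c} := fun t => by
    have : {φ : ℕ → ℕ | ∀ c, φ (t c) = k c} = ⋂ c, (fun φ => φ (t c)) ⁻¹' {k c} := by ext; simp
    rw [this]
    exact .iInter fun c => measurable_pi_apply _ (measurableSet_singleton _)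
  have hmi : ∀ t : D → ℕ, Measurable
      (Set.indicator {φ : ℕ → ℕ | ∀ c, φ (t c) = k c} (1 : (ℕ → ℕ) → ℝ≥0∞)) := fun t =>
    measurable_one.indicator (hms t)
  rw [restaurantLaw, lintegral_map hG measurable_atomic]
  simp_rw [h1]
  have hmw : ∀ t : D → ℕ, Measurable fun w : ℕ → ℝ => ∏ c, ENNReal.ofReal (w (t c)) :=
    fun t => by fun_prop
  have hmt : ∀ t : D → ℕ, Measurable fun p : (ℕ → ℝ) × (ℕ → ℕ) =>
      (∏ c, ENNReal.ofReal (p.1 (t c))) * Set.indicator {φ | ∀ c, φ (t c) = k c} 1 p.2 := fun t =>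
    Measurable.mul (by fun_prop) ((hmi t).comp measurable_snd)
  rw [lintegral_tsum fun t => (hmt t).aemeasurable]
  have h2 : ∀ t : D → ℕ, ∫⁻ p : (ℕ → ℝ) × (ℕ → ℕ), (∏ c, ENNReal.ofReal (p.1 (t c))) *
        Set.indicator {φ | ∀ c, φ (t c) = k c} 1 p.2 ∂(W.prod (iid β)) =
      ∑ V : Setoid D, (if Setoid.ker t = V then
        ∫⁻ w, ∏ c, ENNReal.ofReal (w (t c)) ∂W else 0) * blockProb (fun j => β {j}) V k := by
    intro t
    rw [lintegral_prod_mul (f := fun w : ℕ → ℝ => ∏ c, ENNReal.ofReal (w (t c)))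
      (hmw t).aemeasurable
      (hmi t).aemeasurable, lintegral_indicator_one (hms t), iid_comp_eq]
    simp_rw [ite_mul, zero_mul]
    rw [Finset.sum_ite_eq, if_pos (Finset.mem_univ _)]
  simp_rw [h2]
  rw [tsum_finsetSum_comm fun V (t : D → ℕ) => (if Setoid.ker t = V then
        ∫⁻ w, ∏ c, ENNReal.ofReal (w (t c)) ∂W else 0) * blockProb (fun j => β {j}) V k]
  refine Finset.sum_congr rfl fun V _ => ?_
  rw [ENNReal.tsum_mul_right]
  congr 1
  simp_rw [partitionProb, partitionSum]
  rw [lintegral_tsum fun t => by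
    split_ifs
    exacts [(hmw t).aemeasurable, aemeasurable_const]]
  refine tsum_congr fun t => ?_
  split_ifs <;> simp

/-! ### The partition of the customers of one level by their dishes -/

section Level
variable {C R : Type*} (q : C → R)

/-- The occupied tables, when `V i` groups the customers of restaurant `i` by tables. -/
abbrev Tables (V : ∀ i, Setoid {c // q c = i}) : Type _ := Σ i, Quotient (V i)

/-- The table of a customer. -/
def tableOf (V : ∀ i, Setoid {c // q c = i}) (c : C) : Tables q V :=
  ⟨q c, Quotient.mk (V (q c)) ⟨c, rfl⟩⟩

theorem tableOf_eq (V : ∀ i, Setoid {c // q c = i}) {i : R} (c : {c // q c = i}) :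
    tableOf q V c = ⟨i, Quotient.mk (V i) c⟩ := by
  obtain ⟨c, rfl⟩ := c
  rfl

variable [Fintype C] [Fintype R]

theorem prod_fibers {M : Type*} [CommMonoid M] (f : C → M) :
    ∏ c, f c = ∏ i, ∏ c : {c // q c = i}, f c := by
  rw [← (Equiv.sigmaFiberEquiv q).prod_comp, Fintype.prod_sigma]
  rfl

/-- All restaurants of a level share the dish weights `x`, so their tables can be pooled into one
family of independent dish draws. This pooling is what turns the second stage into a single
partition probability. -/
theorem prod_blockProb (x : ℕ → ℝ≥0∞) (V : ∀ i, Setoid {c // q c = i}) (k : C → ℕ) :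
    ∏ i, blockProb x (V i) (fun c => k c) =
      ∑' κ : Tables q V → ℕ, if (fun c => κ (tableOf q V c)) = k then ∏ B, x (κ B) else 0 := by
  have h := tsum_pi_prod (fun i (κ : Quotient (V i) → ℕ) =>
    if (fun c => κ (Quotient.mk (V i) c)) = (fun c : {c // q c = i} => k c)
      then ∏ B, x (κ B) else 0)
  rw [show ∏ i, blockProb x (V i) (fun c => k c) = _ from h.symm,
    ← (Equiv.piCurry fun i (_ : Quotient (V i)) => ℕ).tsum_eq]
  refine tsum_congr fun κ => ?_
  have h1 : (fun c => κ (tableOf q V c)) = k ↔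
      ∀ i, (fun c => κ ⟨i, Quotient.mk (V i) c⟩) = (fun c : {c // q c = i} => k c) := by
    constructor
    · intro h i
      ext c
      rw [← h, ← tableOf_eq]
    · intro h
      ext c
      exact congrFun (h (q c)) ⟨c, rfl⟩
  by_cases hk : (fun c => κ (tableOf q V c)) = k
  · rw [if_pos hk, Fintype.prod_sigma]
    refine Finset.prod_congr rfl fun i _ => ?_
    exact if_pos (h1.1 hk i)
  · rw [if_neg hk]
    rw [h1] at hk
    push Not at hk
    obtain ⟨i, hi⟩ := hk
    exact Finset.prod_eq_zero (Finset.mem_univ i) (if_neg hi)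

/-- The probability that the customers of a level, who enter the restaurants `q`, are partitioned
by their dishes as prescribed by `S`, when the dish weights have law `B` and the table weights
have law `W i` in restaurant `i`. -/
def levelPartitionProb (B : Measure (ℕ → ℝ)) (W : R → Measure (ℕ → ℝ)) (S : Setoid C) : ℝ≥0∞ :=
  ∑ V : ∀ i, Setoid {c // q c = i}, (∏ i, partitionProb (W i) (V i)) *
    ∑ S' : Setoid (Tables q V), if S'.comap (tableOf q V) = S then partitionProb B S' else 0

/-- The dishes `κ` of the tables determine those of the customers, so the sum over `k` collapses.
The kernel of the resulting `k` is the pullback of the kernel of `κ`. -/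
theorem sum_blockProb (x : ℕ → ℝ≥0∞) (V : ∀ i, Setoid {c // q c = i}) (S : Setoid C) :
    (∑' k : C → ℕ, if Setoid.ker k = S then ∏ i, blockProb x (V i) (fun c => k c) else 0) =
      ∑ S' : Setoid (Tables q V), if S'.comap (tableOf q V) = S then partitionSum S' x else 0 := by
  have h1 : ∀ k : C → ℕ,
      (if Setoid.ker k = S then ∏ i, blockProb x (V i) (fun c => k c) else 0) =
      ∑' κ : Tables q V → ℕ, if (fun c => κ (tableOf q V c)) = k then
        (if (Setoid.ker κ).comap (tableOf q V) = S then ∏ B, x (κ B) else 0) else 0 := by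
    intro k
    rw [prod_blockProb]
    have h2 : ∀ κ : Tables q V → ℕ, (fun c => κ (tableOf q V c)) = k →
        (Setoid.ker κ).comap (tableOf q V) = Setoid.ker k := by
      rintro κ rfl
      rfl
    by_cases hk : Setoid.ker k = S
    · rw [if_pos hk]
      refine tsum_congr fun κ => ?_
      split_ifs with h3 h4
      · rfl
      · exact absurd ((h2 κ h3).trans hk) h4
      · rfl
    · rw [if_neg hk, eq_comm, ENNReal.tsum_eq_zero]
      intro κ
      split_ifs with h3 h4
      · exact absurd ((h2 κ h3).symm.trans h4) hk
      · rfl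
      · rfl
  simp_rw [h1]
  rw [ENNReal.tsum_comm]
  simp_rw [tsum_ite_eq', partitionSum]
  have h2 : ∀ κ : Tables q V → ℕ,
      (if (Setoid.ker κ).comap (tableOf q V) = S then ∏ B, x (κ B) else 0) =
      ∑ S' : Setoid (Tables q V), if S'.comap (tableOf q V) = S then
        (if Setoid.ker κ = S' then ∏ B, x (κ B) else 0) else 0 := by
    intro κ
    rw [Finset.sum_eq_single (Setoid.ker κ)]
    · simp
    · intro S' _ hS'
      rw [if_neg (Ne.symm hS'), ite_self]
    · simp
  simp_rw [h2]
  rw [tsum_finsetSum_comm]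
  refine Finset.sum_congr rfl fun S' _ => ?_
  split_ifs <;> simp

theorem measurable_prod_apply {C : Type*} [Fintype C] (r k : C → ℕ) :
    Measurable fun G : ℕ → Measure ℕ => ∏ c, G (r c) {k c} :=
  Finset.measurable_prod _ fun _ _ =>
    (Measure.measurable_coe (measurableSet_singleton _)).comp (measurable_pi_apply _)

theorem lintegral_infinitePi_restaurantLaw {b : ℕ → ℝ} (hb : ∑' k, ENNReal.ofReal (b k) = 1)
    (W : ℕ → Measure (ℕ → ℝ)) [∀ r, IsProbabilityMeasure (W r)] {ρ : R → ℕ}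
    (hρ : Function.Injective ρ) (k : C → ℕ) :
    ∫⁻ G, ∏ c, G (ρ (q c)) {k c}
      ∂(Measure.infinitePi fun r => restaurantLaw (W r) (categorical b)) =
      ∑ V : ∀ i, Setoid {c // q c = i}, (∏ i, partitionProb (W (ρ i)) (V i)) *
        ∏ i, blockProb (fun j => ENNReal.ofReal (b j)) (V i) (fun c => k c) := by
  have := isProbabilityMeasure_categorical hb
  have h2 : ∀ G : ℕ → Measure ℕ, ∏ c, G (ρ (q c)) {k c} =
      ∏ i, ∏ c : {c // q c = i}, G (ρ i) {k c} := by
    intro G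
    rw [prod_fibers q]
    refine Finset.prod_congr rfl fun i _ => Finset.prod_congr rfl fun c _ => ?_
    rw [c.2]
  simp_rw [h2]
  rw [lintegral_infinitePi_prod (fun r => restaurantLaw (W r) (categorical b)) ρ hρ
    (fun i (G : Measure ℕ) => ∏ c : {c // q c = i}, G {k c}) fun i =>
      Finset.measurable_prod _ fun c _ => Measure.measurable_coe (measurableSet_singleton _)]
  simp_rw [lintegral_restaurantLaw, categorical_singleton]
  rw [Finset.prod_univ_sum, Fintype.piFinset_univ]
  simp_rw [Finset.prod_mul_distrib]

/-- Dishes of weight zero are never served. -/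
theorem lintegral_levelLaw_eq_zero {B : Measure (ℕ → ℝ)}
    (hB : ∀ᵐ b ∂B, ∑' k, ENNReal.ofReal (b k) = 1) (W : ℕ → Measure (ℕ → ℝ))
    [∀ r, IsProbabilityMeasure (W r)] {ρ : R → ℕ} (hρ : Function.Injective ρ) {k : C → ℕ} {c : C}
    (hc : ∀ᵐ b ∂B, b (k c) = 0) :
    ∫⁻ G, ∏ c, G (ρ (q c)) {k c} ∂(levelLaw B W) = 0 := by
  rw [lintegral_levelLaw hB W (measurable_prod_apply _ k), ← lintegral_zero (μ := B)]
  refine lintegral_congr_ae ?_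
  filter_upwards [hB, hc] with b hb hbc
  rw [lintegral_infinitePi_restaurantLaw q hb W hρ]
  refine Finset.sum_eq_zero fun V _ => ?_
  rw [prod_blockProb, ENNReal.tsum_eq_zero.2, mul_zero]
  intro κ
  split_ifs with hκ
  · refine Finset.prod_eq_zero (Finset.mem_univ (tableOf q V c)) ?_
    rw [congrFun hκ c, hbc, ENNReal.ofReal_zero]
  · rfl

/-- Given the dish weights `b`, distinct restaurants are independent and each separates into seating
and dishes. The seating probabilities do not involve `b`, so only the dish stage is averaged over
`B`. The injective numbering `ρ` of the restaurants survives only in their table-weight laws. -/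
theorem tsum_lintegral_levelLaw {B : Measure (ℕ → ℝ)}
    (hB : ∀ᵐ b ∂B, ∑' k, ENNReal.ofReal (b k) = 1) (W : ℕ → Measure (ℕ → ℝ))
    [∀ r, IsProbabilityMeasure (W r)] {ρ : R → ℕ} (hρ : Function.Injective ρ) (S : Setoid C) :
    (∑' k : C → ℕ, if Setoid.ker k = S then
      ∫⁻ G, ∏ c, G (ρ (q c)) {k c} ∂(levelLaw B W) else 0) =
      levelPartitionProb q B (fun i => W (ρ i)) S := by
  have h1 : ∀ᵐ b ∂B, ∀ k : C → ℕ, ∫⁻ G, ∏ c, G (ρ (q c)) {k c}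
      ∂(Measure.infinitePi fun r => restaurantLaw (W r) (categorical b)) =
      ∑ V : ∀ i, Setoid {c // q c = i}, (∏ i, partitionProb (W (ρ i)) (V i)) *
        ∏ i, blockProb (fun j => ENNReal.ofReal (b j)) (V i) (fun c => k c) := by
    filter_upwards [hB] with b hb k using lintegral_infinitePi_restaurantLaw q hb W hρ k
  have h2 : ∀ k : C → ℕ, (if Setoid.ker k = S then
      ∫⁻ G, ∏ c, G (ρ (q c)) {k c} ∂(levelLaw B W) else 0) =
      ∫⁻ b, (if Setoid.ker k = S then ∑ V : ∀ i, Setoid {c // q c = i},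
        (∏ i, partitionProb (W (ρ i)) (V i)) *
          ∏ i, blockProb (fun j => ENNReal.ofReal (b j)) (V i) (fun c => k c) else 0) ∂B := by
    intro k
    split_ifs with hk
    · rw [lintegral_levelLaw hB W (measurable_prod_apply _ _)]
      exact lintegral_congr_ae (h1.mono fun b hb => hb k)
    · simp
  have hm1 : ∀ {D : Type _} [Fintype D] (V : Setoid D) (k : D → ℕ), Measurable fun b : ℕ → ℝ =>
      blockProb (fun j => ENNReal.ofReal (b j)) V k := by
    intro D _ V k
    refine Measurable.tsum fun κ => ?_
    split_ifs <;> fun_prop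
  have hm2 : ∀ (V : ∀ i, Setoid {c // q c = i}) (k : C → ℕ), Measurable fun b : ℕ → ℝ =>
      (∏ i, partitionProb (W (ρ i)) (V i)) *
          ∏ i, blockProb (fun j => ENNReal.ofReal (b j)) (V i) (fun c => k c) := fun V k =>
    (Finset.measurable_prod _ fun i _ => hm1 (V i) _).const_mul _
  simp_rw [h2]
  rw [← lintegral_tsum fun k => by
    split_ifs
    exacts [(Finset.measurable_sum _ fun V _ => hm2 V k).aemeasurable, aemeasurable_const]]
  have h3 : ∀ b : ℕ → ℝ, (∑' k : C → ℕ, if Setoid.ker k = S then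
      ∑ V : ∀ i, Setoid {c // q c = i}, (∏ i, partitionProb (W (ρ i)) (V i)) *
          ∏ i, blockProb (fun j => ENNReal.ofReal (b j)) (V i) (fun c => k c) else 0) =
      ∑ V : ∀ i, Setoid {c // q c = i}, (∏ i, partitionProb (W (ρ i)) (V i)) *
        ∑ S' : Setoid (Tables q V), if S'.comap (tableOf q V) = S then
          partitionSum S' (fun j => ENNReal.ofReal (b j)) else 0 := by
    intro b
    simp_rw [← sum_blockProb, ← ENNReal.tsum_mul_left]
    rw [← tsum_finsetSum_comm]
    refine tsum_congr fun k => ?_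
    split_ifs <;> simp
  have hm3 : ∀ {D : Type _} [Fintype D] (V : Setoid D), Measurable fun b : ℕ → ℝ =>
      partitionSum V (fun j => ENNReal.ofReal (b j)) := fun V =>
    (measurable_partitionSum V).comp (by fun_prop)
  have hm4 : ∀ (V : ∀ i, Setoid {c // q c = i}) (S' : Setoid (Tables q V)),
      Measurable fun b : ℕ → ℝ => if S'.comap (tableOf q V) = S then
          partitionSum S' (fun j => ENNReal.ofReal (b j)) else 0 := by
    intro V S'
    split_ifs
    exacts [hm3 S', measurable_const]
  simp_rw [h3]
  rw [lintegral_finsetSum _ fun V _ => (Finset.measurable_sum _ fun S' _ => hm4 V S').const_mul _,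
    levelPartitionProb]
  refine Finset.sum_congr rfl fun V _ => ?_
  rw [lintegral_const_mul _ (Finset.measurable_sum _ fun S' _ => hm4 V S'),
    lintegral_finsetSum _ fun S' _ => hm4 V S']
  congr 1
  refine Finset.sum_congr rfl fun S' _ => ?_
  split_ifs
  · rfl
  · simp

theorem levelPartitionProb_gem_ne_top {γ α : ℝ} (hγ : 0 < γ) (hα : 0 < α) (S : Setoid C) :
    levelPartitionProb q (gem γ) (fun _ => gem α) S ≠ ∞ := by
  refine ENNReal.sum_ne_top.2 fun V _ => ENNReal.mul_ne_top
    (ENNReal.prod_ne_top fun i _ => partitionProb_gem_ne_top hα _)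
    (ENNReal.sum_ne_top.2 fun S' _ => ?_)
  split_ifs
  exacts [partitionProb_gem_ne_top hγ _, ENNReal.zero_ne_top]

/-- A transition probability is a finite polynomial in partition probabilities with finite limits,
so termwise convergence suffices. -/
theorem tendsto_levelPartitionProb {γ α : ℝ} (hγ : 0 < γ) (hα : 0 < α) (S : Setoid C) :
    Tendsto (fun p : ℕ × (R → ℕ) => levelPartitionProb q (symDirichlet γ p.1)
      (fun i => symDirichlet α (p.2 i)) S) atTop
      (𝓝 (levelPartitionProb q (gem γ) (fun _ => gem α) S)) := by
  have hfst : Tendsto (fun p : ℕ × (R → ℕ) => p.1) atTop atTop := by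
    rw [← prod_atTop_atTop_eq]; exact tendsto_fst
  have hsnd : ∀ i, Tendsto (fun p : ℕ × (R → ℕ) => p.2 i) atTop atTop := fun i => by
    refine tendsto_atTop.2 fun n => ?_
    filter_upwards [eventually_ge_atTop ((0, fun _ => n) : ℕ × (R → ℕ))] with p hp
    exact hp.2 i
  have htop : ∀ V : ∀ i, Setoid {c // q c = i}, ∏ i, partitionProb (gem α) (V i) ≠ ∞ := fun V =>
    ENNReal.prod_ne_top fun i _ => partitionProb_gem_ne_top hα _
  have htop' : ∀ V : ∀ i, Setoid {c // q c = i}, (∑ S' : Setoid (Tables q V),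
      if S'.comap (tableOf q V) = S then partitionProb (gem γ) S' else 0) ≠ ∞ := fun V => by
    refine ENNReal.sum_ne_top.2 fun S' _ => ?_
    split_ifs
    exacts [partitionProb_gem_ne_top hγ _, ENNReal.zero_ne_top]
  refine tendsto_finsetSum _ fun V _ => ENNReal.Tendsto.mul ?_ (.inr (htop' V)) ?_ (.inr (htop V))
  · exact ENNReal.tendsto_finsetProd_of_ne_top _
      (fun i _ => (tendsto_partitionProb hα (V i)).comp (hsnd i))
      fun i _ => partitionProb_gem_ne_top hα _
  · refine tendsto_finsetSum _ fun S' _ => ?_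
    split_ifs
    · exact (tendsto_partitionProb hγ S').comp hfst
    · exact tendsto_const_nhds

end Level

/-! ### The law of the outcome -/

/-- The entry of `z` one level above `l`, or `top` above the outermost level. -/
def parent {A : Type*} {n : ℕ} (top : A) (z : Fin n → A) (l : Fin n) : A :=
  if h : (l : ℕ) + 1 < n then z ⟨l + 1, h⟩ else top

theorem map_parent {A B : Type*} (f : A → B) {n : ℕ} (top : A) (z : Fin n → A) (l : Fin n) :
    f (parent top z l) = parent (f top) (fun l => f (z l)) l := by
  unfold parent
  split_ifs <;> rfl

theorem restaurant_eq_parent {L : ℕ} (j : ℕ) (z : Fin (L + 1) → ℕ) (l : Fin (L + 1)) :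
    restaurant j z l = parent j z l := rfl

section Outcome
variable {L M : ℕ} (N : Fin M → ℕ)

theorem routing_singleton (G : Fin (L + 1) → ℕ → Measure ℕ)
    (z : Customer M N → Fin (L + 1) → ℕ) :
    routing N G {z} = ∏ l, ∏ c, G l (restaurant c.1 (z c) l) {z c l} := by
  rw [routing, Measure.sum_apply _ (measurableSet_singleton z), tsum_eq_single z, Finset.prod_comm]
  · simp
  · intro z' hz'
    simp [hz']

theorem measurable_routing : Measurable (routing (L := L) N) := by
  refine Measure.measurable_of_measurable_coe _ fun s hs => ?_
  simp_rw [routing, Measure.sum_apply _ hs, Measure.smul_apply, smul_eq_mul]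
  refine Measurable.tsum fun z => Measurable.mul_const (Finset.measurable_prod _ fun c _ =>
    Finset.measurable_prod _ fun l _ => ?_) _
  exact (Measure.measurable_coe (measurableSet_singleton _)).comp
    ((measurable_pi_apply _).comp (measurable_pi_apply l))

/-- The restaurants of all customers at level `l`. -/
def entered (z : Fin (L + 1) → Customer M N → ℕ) (l : Fin (L + 1)) : Customer M N → ℕ :=
  parent (fun c => (c.1 : ℕ)) z l

theorem bind_routing_singleton (level : Fin (L + 1) → Measure (ℕ → Measure ℕ))
    [∀ l, IsProbabilityMeasure (level l)] (z : Customer M N → Fin (L + 1) → ℕ) :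
    ((Measure.pi level).bind (routing N)) {z} =
      ∏ l, ∫⁻ G, ∏ c, G (entered N (fun l c => z c l) l c) {z c l} ∂(level l) := by
  rw [Measure.bind_apply (measurableSet_singleton z) (measurable_routing N).aemeasurable]
  simp_rw [routing_singleton]
  rw [lintegral_fintype_prod_eq_prod
    (fun l (G : ℕ → Measure ℕ) => ∏ c : Customer M N, G (restaurant c.1 (z c) l) {z c l})
    fun l => measurable_prod_apply _ _]
  refine Finset.prod_congr rfl fun l _ => lintegral_congr fun G =>
    Finset.prod_congr rfl fun c _ => ?_
  rw [restaurant_eq_parent, entered, map_parent (fun f : Customer M N → ℕ => f c)]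

/-- The probability that the dishes of each level `l` partition the customers into the blocks of
`R l`. -/
def dishPartitionProb (level : Fin (L + 1) → Measure (ℕ → Measure ℕ))
    (R : Fin (L + 1) → Setoid (Customer M N)) : ℝ≥0∞ :=
  ∑' z : Fin (L + 1) → Customer M N → ℕ, if (fun l => Setoid.ker (z l)) = R then
    ∏ l, ∫⁻ G, ∏ c, G (entered N z l c) {z l c} ∂(level l) else 0

variable {Θ X : Type*} [MeasurableSpace Θ] [MeasurableSpace X]

/-- The law of the outcome, given the partitions `R` and the topics `θ`. -/
def dataLaw (F : Kernel Θ X) (R : Fin (L + 1) → Setoid (Customer M N)) (θ : Customer M N → Θ) :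
    Measure (Outcome L M N Θ X) :=
  (Measure.pi fun c => F (θ c)).map fun x => (fun l c c' => R l c c', θ, x)

instance (F : Kernel Θ X) [IsMarkovKernel F] (R : Fin (L + 1) → Setoid (Customer M N))
    (θ : Customer M N → Θ) : IsProbabilityMeasure (dataLaw N F R θ) :=
  Measure.isProbabilityMeasure_map (by fun_prop)

theorem measurable_dataLaw (F : Kernel Θ X) [IsMarkovKernel F]
    (R : Fin (L + 1) → Setoid (Customer M N)) : Measurable (dataLaw N F R) := by
  have hpi : Measurable fun θ : Customer M N → Θ => Measure.pi fun c => F (θ c) :=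
    measurable_measure_pi (fun (θ : Customer M N → Θ) c => F (θ c)) fun c =>
      F.measurable.comp (measurable_pi_apply c)
  let κ : Kernel (Customer M N → Θ) (Customer M N → X) := ⟨_, hpi⟩
  have : IsMarkovKernel κ :=
    ⟨fun θ => inferInstanceAs (IsProbabilityMeasure (Measure.pi fun c => F (θ c)))⟩
  refine Measure.measurable_of_measurable_coe _ fun s hs => ?_
  have hm : Measurable fun p : (Customer M N → Θ) × (Customer M N → X) =>
      ((fun l c c' => R l c c', p.1, p.2) : Outcome L M N Θ X) := by fun_prop
  have h := Kernel.measurable_kernel_prodMk_left (κ := κ) (hm hs)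
  have he : (fun θ => dataLaw N F R θ s) = fun θ => κ θ (Prod.mk θ ⁻¹'
      ((fun p => ((fun l c c' => R l c c', p.1, p.2) : Outcome L M N Θ X)) ⁻¹' s)) := by
    ext θ
    rw [dataLaw, Measure.map_apply (by fun_prop) hs]
    rfl
  rw [he]
  exact h

/-- The probability of the outcomes `A`, given the partitions `R`. -/
def outcomeGiven (H : Measure Θ) (F : Kernel Θ X) (R : Fin (L + 1) → Setoid (Customer M N))
    (A : Set (Outcome L M N Θ X)) : ℝ≥0∞ :=
  ∫⁻ ψ : Quotient (R 0) → Θ, dataLaw N F R (fun c => ψ (Quotient.mk (R 0) c)) A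
    ∂(Measure.pi fun _ => H)

theorem outcomeGiven_le_one (H : Measure Θ) [IsProbabilityMeasure H] (F : Kernel Θ X)
    [IsMarkovKernel F] (R : Fin (L + 1) → Setoid (Customer M N))
    (A : Set (Outcome L M N Θ X)) : outcomeGiven N H F R A ≤ 1 :=
  (lintegral_mono fun _ => prob_le_one).trans (by simp)

/-- The kernel from dishes and topics to outcomes factors through the dish partitions and the
customers' topics, and the law of these topics depends only on the kernel of the level-0 dishes
(`map_iid_comp`). The dependence on `level` is thereby confined to the weights. -/
theorem outcomeLaw_apply (level : Fin (L + 1) → Measure (ℕ → Measure ℕ))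
    [∀ l, IsProbabilityMeasure (level l)] (H : Measure Θ) [IsProbabilityMeasure H]
    (F : Kernel Θ X) [IsMarkovKernel F] {A : Set (Outcome L M N Θ X)} (hA : MeasurableSet A) :
    outcomeLaw N level H F A = ∑ R : Fin (L + 1) → Setoid (Customer M N),
      dishPartitionProb N level R * outcomeGiven N H F R A := by
  set μ := (Measure.pi level).bind (routing N) with hμ
  -- On a countable space every measure is a sum of weighted Dirac masses; s-finiteness is all that
  -- Tonelli needs here.
  have : SFinite μ := by
    rw [← Measure.sum_smul_dirac μ]
    infer_instance
  let part : (Customer M N → Fin (L + 1) → ℕ) → Fin (L + 1) → Setoid (Customer M N) :=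
    fun z l => Setoid.ker fun c => z c l
  let κ : (Customer M N → Fin (L + 1) → ℕ) × (ℕ → Θ) → Measure (Outcome L M N Θ X) :=
    fun p => dataLaw N F (part p.1) fun c => p.2 (p.1 c 0)
  have hκ : Measurable κ := measurable_from_prod_countable_right fun z =>
    (measurable_dataLaw N F (part z)).comp
      (measurable_pi_lambda _ fun c => measurable_pi_apply _)
  have h1 : outcomeLaw N level H F = (μ.prod (iid H)).bind κ := rfl
  have h2 : ∀ z, ∫⁻ φ, κ (z, φ) A ∂(iid H) = outcomeGiven N H F (part z) A := by
    intro z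
    have hA' : Measurable fun θ => dataLaw N F (part z) θ A :=
      (Measure.measurable_coe hA).comp (measurable_dataLaw N F (part z))
    have h3 := congrArg (fun ν => ∫⁻ θ, dataLaw N F (part z) θ A ∂ν)
      (map_iid_comp H fun c => z c 0)
    rw [lintegral_map hA' (measurable_pi_lambda _ fun c => measurable_pi_apply _),
      lintegral_map hA' (measurable_pi_lambda _ fun c => measurable_pi_apply _)] at h3
    exact h3
  rw [h1, Measure.bind_apply hA hκ.aemeasurable,
    lintegral_prod (fun p => κ p A) ((Measure.measurable_coe hA).comp hκ).aemeasurable,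
    lintegral_countable']
  simp_rw [h2, hμ, bind_routing_singleton]
  rw [← (Equiv.piComm fun (_ : Fin (L + 1)) (_ : Customer M N) => ℕ).tsum_eq]
  have h4 : ∀ z : Fin (L + 1) → Customer M N → ℕ,
      outcomeGiven N H F (fun l => Setoid.ker (z l)) A *
        ∏ l, ∫⁻ G, ∏ c, G (entered N z l c) {z l c} ∂(level l) =
      ∑ R : Fin (L + 1) → Setoid (Customer M N), (if (fun l => Setoid.ker (z l)) = R then
        ∏ l, ∫⁻ G, ∏ c, G (entered N z l c) {z l c} ∂(level l) else 0) *
          outcomeGiven N H F R A := by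
    intro z
    simp_rw [ite_mul, zero_mul]
    rw [Finset.sum_ite_eq, if_pos (Finset.mem_univ _), mul_comm]
  refine (tsum_congr h4).trans ?_
  rw [tsum_finsetSum_comm fun (R : Fin (L + 1) → Setoid (Customer M N))
    (z : Fin (L + 1) → Customer M N → ℕ) => (if (fun l => Setoid.ker (z l)) = R then
        ∏ l, ∫⁻ G, ∏ c, G (entered N z l c) {z l c} ∂(level l) else 0) *
          outcomeGiven N H F R A]
  refine Finset.sum_congr rfl fun R _ => ?_
  rw [ENNReal.tsum_mul_right, dishPartitionProb]

end Outcome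

/-! ### Chains of levels -/

theorem parent_snoc_castSucc {A : Type*} {n : ℕ} (top y : A) (z : Fin n → A) (l : Fin n) :
    parent top (Fin.snoc z y : Fin (n + 1) → A) l.castSucc = parent y z l := by
  unfold parent
  have hl : ((l.castSucc : Fin (n + 1)) : ℕ) + 1 < n + 1 := by simp
  rw [dif_pos hl]
  split_ifs with h
  · exact Fin.snoc_castSucc (α := fun _ => A) y z ⟨l + 1, h⟩
  · have h1 : (⟨(l.castSucc : Fin (n + 1)) + 1, hl⟩ : Fin (n + 1)) = Fin.last n := by
      ext
      simp only [Fin.val_castSucc, Fin.val_last]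
      omega
    rw [h1]
    exact Fin.snoc_last (α := fun _ => A) y z

theorem parent_last {A : Type*} {n : ℕ} (top : A) (z : Fin (n + 1) → A) :
    parent top z (Fin.last n) = top := by
  simp [parent]

/-- Bounds for the transition from the restaurants to the partition by dishes of each level
multiply along a chain of levels. It suffices to have the bounds for the admissible restaurants,
when dishes outside these have probability zero. -/
theorem chain_mem_Icc {C : Type*} [Fintype C] {n : ℕ}
    (q : Fin n → (C → ℕ) → (C → ℕ) → ℝ≥0∞) (adm : Fin n → (C → ℕ) → Prop)
    (R : Fin n → Setoid C) (a b : Fin n → ℝ≥0∞) (top : C → ℕ)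
    (htop : ∀ l : Fin n, (l : ℕ) + 1 = n → adm l top)
    (hq : ∀ l r, adm l r → Setoid.ker r = parent (Setoid.ker top) R l →
      (∑' k, if Setoid.ker k = R l then q l r k else 0) ∈ Set.Icc (a l) (b l))
    (hadm : ∀ l r k, q l r k ≠ 0 → ∀ l' : Fin n, (l' : ℕ) + 1 = l → adm l' k) :
    (∑' z : Fin n → C → ℕ, if (fun l => Setoid.ker (z l)) = R then
      ∏ l, q l (parent top z l) (z l) else 0) ∈ Set.Icc (∏ l, a l) (∏ l, b l) := by
  induction n generalizing top with
  | zero =>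
    rw [tsum_eq_single (fun l => l.elim0) fun z hz => absurd (Subsingleton.elim _ _) hz,
      if_pos (Subsingleton.elim _ _)]
    simp
  | succ n ih =>
    -- The outermost level `Fin.last n` is peeled off; its dishes `y` are the top restaurants of the
    -- remaining chain.
    have hsplit : (∑' z : Fin (n + 1) → C → ℕ, if (fun l => Setoid.ker (z l)) = R then
        ∏ l, q l (parent top z l) (z l) else 0) =
        ∑' y : C → ℕ, (if Setoid.ker y = R (Fin.last n) then q (Fin.last n) top y else 0) *
          ∑' z : Fin n → C → ℕ, if (fun l => Setoid.ker (z l)) = fun l => R l.castSucc then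
            ∏ l : Fin n, q l.castSucc (parent y z l) (z l) else 0 := by
      simp_rw [← ENNReal.tsum_mul_left]
      rw [← ENNReal.tsum_prod, ← (Fin.snocEquiv fun _ : Fin (n + 1) => C → ℕ).tsum_eq]
      refine tsum_congr fun p => ?_
      obtain ⟨y, z⟩ := p
      have hs : (Fin.snocEquiv fun _ : Fin (n + 1) => C → ℕ) (y, z) =
          (Fin.snoc z y : Fin (n + 1) → C → ℕ) := rfl
      have h0 : ∀ l, (Fin.snoc z y : Fin (n + 1) → C → ℕ) (Fin.castSucc l) = z l := fun l =>
        Fin.snoc_castSucc (α := fun _ => C → ℕ) y z l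
      have h1 : (Fin.snoc z y : Fin (n + 1) → C → ℕ) (Fin.last n) = y :=
        Fin.snoc_last (α := fun _ => C → ℕ) y z
      have hiff : (fun l => Setoid.ker ((Fin.snoc z y : Fin (n + 1) → C → ℕ) l)) = R ↔
          Setoid.ker y = R (Fin.last n) ∧
            (fun l => Setoid.ker (z l)) = fun l => R l.castSucc := by
        constructor
        · intro h
          refine ⟨by rw [← congrFun h, h1], ?_⟩
          ext1 l
          rw [← congrFun h, h0]
        · rintro ⟨hy, hz⟩
          ext1 l
          refine Fin.lastCases ?_ (fun l => ?_) l
          · rw [h1, hy]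
          · rw [h0]; exact congrFun hz l
      rw [hs, Fin.prod_univ_castSucc]
      simp_rw [parent_snoc_castSucc, parent_last, h0, h1]
      by_cases hy : Setoid.ker y = R (Fin.last n)
      · by_cases hz : (fun l => Setoid.ker (z l)) = fun l => R l.castSucc
        · rw [if_pos (hiff.2 ⟨hy, hz⟩), if_pos hy, if_pos hz, mul_comm]
        · rw [if_neg fun h => hz (hiff.1 h).2, if_neg hz, mul_zero]
      · rw [if_neg fun h => hy (hiff.1 h).1, if_neg hy, zero_mul]
    have hlast := hq (Fin.last n) top (htop _ (by simp)) (by rw [parent_last])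
    -- The induction hypothesis bounds the inner sum uniformly in `y`, because only the kernel of
    -- `y` enters the bounds. Nonzero probability of `y` supplies its admissibility.
    have hrest : ∀ y : C → ℕ, Setoid.ker y = R (Fin.last n) → q (Fin.last n) top y ≠ 0 →
        (∑' z : Fin n → C → ℕ, if (fun l => Setoid.ker (z l)) = fun l => R l.castSucc then
            ∏ l : Fin n, q l.castSucc (parent y z l) (z l) else 0) ∈
          Set.Icc (∏ l : Fin n, a l.castSucc) (∏ l : Fin n, b l.castSucc) := by
      intro y hy hne
      refine ih (fun l => q l.castSucc) (fun l => adm l.castSucc) (fun l => R l.castSucc) _ _ y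
        (fun l hl => hadm _ _ _ hne _ (by simpa using hl)) (fun l r hr hk => ?_)
        fun l r k hk l' hl' => hadm _ _ _ hk _ (by simpa using hl')
      refine hq _ _ hr ?_
      have hR : R = (Fin.snoc (fun l : Fin n => R l.castSucc) (R (Fin.last n)) :
          Fin (n + 1) → Setoid C) := (Fin.snoc_init_self R).symm
      rw [hk, hy, hR, parent_snoc_castSucc]
      congr 1
      · exact (Fin.snoc_last (α := fun _ => Setoid C) _ _)
      · ext1 l
        exact (Fin.snoc_castSucc (α := fun _ => Setoid C) _ _ l)
    rw [hsplit, Fin.prod_univ_castSucc, Fin.prod_univ_castSucc]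
    constructor
    · rw [mul_comm]
      refine (mul_le_mul_left hlast.1 _).trans ?_
      rw [← ENNReal.tsum_mul_right]
      refine ENNReal.tsum_le_tsum fun y => ?_
      split_ifs with hy
      · by_cases hne : q (Fin.last n) top y = 0
        · simp [hne]
        · exact mul_le_mul_right (hrest y hy hne).1 _
      · simp
    · rw [mul_comm]
      refine le_trans ?_ (mul_le_mul_left hlast.2 _)
      rw [← ENNReal.tsum_mul_right]
      refine ENNReal.tsum_le_tsum fun y => ?_
      split_ifs with hy
      · by_cases hne : q (Fin.last n) top y = 0
        · simp [hne]
        · exact mul_le_mul_right (hrest y hy hne).2 _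
      · simp

/-! ### Convergence of the partition probabilities -/

/-- The probability, in a level of the nested hierarchical Dirichlet process, that customers who
are partitioned by restaurants as prescribed by `S'` are partitioned by dishes as prescribed by
`S`. -/
def hdpTransition {C : Type*} [Fintype C] (γ α : ℝ) (S' S : Setoid C) : ℝ≥0∞ :=
  levelPartitionProb (Quotient.mk S') (gem γ) (fun _ => gem α) S

theorem exists_factor {C : Type*} {S' : Setoid C} {r : C → ℕ} (hr : Setoid.ker r = S') :
    ∃ ρ : Quotient S' → ℕ, Function.Injective ρ ∧ r = fun c => ρ (Quotient.mk S' c) := by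
  subst hr
  exact ⟨_, Setoid.kerLift_injective r, rfl⟩

theorem tsum_nHDPLevel {C : Type*} [Fintype C] {γ α : ℝ} (hγ : 0 < γ) (hα : 0 < α)
    {S' : Setoid C} (S : Setoid C) {r : C → ℕ} (hr : Setoid.ker r = S') :
    (∑' k : C → ℕ, if Setoid.ker k = S then ∫⁻ G, ∏ c, G (r c) {k c} ∂(nHDPLevel γ α) else 0) =
      hdpTransition γ α S' S := by
  have := isProbabilityMeasure_gem hα
  obtain ⟨ρ, hρ, rfl⟩ := exists_factor hr
  exact tsum_lintegral_levelLaw (Quotient.mk S') (ae_gem_tsum_eq hγ) (fun _ => gem α) hρ S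

/-- The threshold must be uniform in `r`. This is possible because, for fixed `S'`, the transition
depends on `r` only through the table counts of the finitely many restaurants entered. -/
theorem exists_tsum_finiteLevel_mem_Icc {C : Type*} [Fintype C] {γ α : ℝ} (hγ : 0 < γ)
    (hα : 0 < α) (S' S : Setoid C) {δ : ℝ≥0∞} (hδ : 0 < δ) :
    ∃ n : ℕ, ∀ (K : ℕ) (T : ℕ → ℕ) (r : C → ℕ), n ≤ K → (∀ c, n ≤ T (r c)) →
      Setoid.ker r = S' →
      (∑' k : C → ℕ, if Setoid.ker k = S then
        ∫⁻ G, ∏ c, G (r c) {k c} ∂(finiteLevel γ α K T) else 0) ∈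
        Set.Icc (hdpTransition γ α S' S - δ) (hdpTransition γ α S' S + δ) := by
  have h := (ENNReal.tendsto_nhds (levelPartitionProb_gem_ne_top _ hγ hα S)).1
    (tendsto_levelPartitionProb (Quotient.mk S') hγ hα S) δ hδ
  obtain ⟨⟨K₀, T₀⟩, h⟩ := eventually_atTop.1 h
  -- The summand 1 forces `K > 0`, so that the dish weights sum to 1.
  refine ⟨K₀ + 1 + Finset.univ.sup T₀, fun K T r hK hT hr => ?_⟩
  obtain ⟨ρ, hρ, rfl⟩ := exists_factor hr
  have := fun r => isProbabilityMeasure_symDirichlet hα (T r)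
  rw [finiteLevel_eq, tsum_lintegral_levelLaw (Quotient.mk S')
    (ae_symDirichlet_tsum_eq hγ (by omega)) (fun r => symDirichlet α (T r)) hρ S]
  refine h (K, fun i => T (ρ i)) ⟨?_, fun i => ?_⟩
  · change K₀ ≤ K
    omega
  · obtain ⟨c, rfl⟩ := Quotient.exists_rep i
    have h1 := Finset.le_sup (f := T₀) (Finset.mem_univ (Quotient.mk S' c))
    have h2 : _ ≤ T (ρ (Quotient.mk S' c)) := hT c
    change T₀ _ ≤ T _
    omega

/-- This keeps the chain among the restaurants below `numRestaurants`, the only ones whose table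
counts are controlled. -/
theorem finiteLevel_eq_zero {C : Type*} [Fintype C] {γ α : ℝ} (hγ : 0 < γ) (hα : 0 < α)
    {K : ℕ} (hK : 0 < K) (T : ℕ → ℕ) {r k : C → ℕ} {c : C} (hc : K ≤ k c) :
    ∫⁻ G, ∏ c, G (r c) {k c} ∂(finiteLevel γ α K T) = 0 := by
  have := fun r => isProbabilityMeasure_symDirichlet hα (T r)
  obtain ⟨S', hS'⟩ : ∃ S', Setoid.ker r = S' := ⟨_, rfl⟩
  obtain ⟨ρ, hρ, rfl⟩ := exists_factor hS'
  rw [finiteLevel_eq]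
  exact lintegral_levelLaw_eq_zero _ (ae_symDirichlet_tsum_eq hγ hK) _ hρ
    ((ae_symDirichlet_eq_zero γ K).mono fun b hb => hb _ hc)

section Chain
variable {L M : ℕ} (N : Fin M → ℕ) {γ α : Fin (L + 1) → ℝ}

/-- The partition of the customers by the restaurants of level `l`, when `R` are the partitions by
dishes. -/
def enteredPartition (R : Fin (L + 1) → Setoid (Customer M N)) (l : Fin (L + 1)) :
    Setoid (Customer M N) :=
  parent (Setoid.ker fun c => (c.1 : ℕ)) R l

/-- Every nHDP transition depends on the restaurants only through their kernel, so `chain_mem_Icc`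
applies with equal lower and upper bounds, all restaurants being admissible. -/
theorem dishPartitionProb_nHDPLevel (hγ : ∀ l, 0 < γ l) (hα : ∀ l, 0 < α l)
    (R : Fin (L + 1) → Setoid (Customer M N)) :
    dishPartitionProb N (fun l => nHDPLevel (γ l) (α l)) R =
      ∏ l, hdpTransition (γ l) (α l) (enteredPartition N R l) (R l) := by
  have h := chain_mem_Icc
    (fun l r k => ∫⁻ G, ∏ c : Customer M N, G (r c) {k c} ∂(nHDPLevel (γ l) (α l)))
    (fun _ _ => True) R (fun l => hdpTransition (γ l) (α l) (enteredPartition N R l) (R l))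
    (fun l => hdpTransition (γ l) (α l) (enteredPartition N R l) (R l))
    (fun c => (c.1 : ℕ)) (fun _ _ => trivial)
    (fun l r _ hr => by rw [tsum_nHDPLevel (hγ l) (hα l) (R l) hr]; exact ⟨le_rfl, le_rfl⟩)
    (fun _ _ _ _ _ _ => trivial)
  exact le_antisymm h.2 h.1

theorem exists_dishPartitionProb_mem_Icc (hγ : ∀ l, 0 < γ l) (hα : ∀ l, 0 < α l)
    (R : Fin (L + 1) → Setoid (Customer M N)) {η : ℝ≥0∞} (hη : 0 < η) :
    ∃ n : ℕ, ∀ (K : Fin (L + 1) → ℕ) (T : Fin (L + 1) → ℕ → ℕ), (∀ l, n ≤ K l) →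
      (∀ l r, r < numRestaurants M K l → n ≤ T l r) →
      dishPartitionProb N (fun l => finiteLevel (γ l) (α l) (K l) (T l)) R ∈
        Set.Icc (dishPartitionProb N (fun l => nHDPLevel (γ l) (α l)) R - η)
          (dishPartitionProb N (fun l => nHDPLevel (γ l) (α l)) R + η) := by
  rw [dishPartitionProb_nHDPLevel N hγ hα]
  set a : Fin (L + 1) → ℝ≥0∞ := fun l =>
    hdpTransition (γ l) (α l) (enteredPartition N R l) (R l) with ha
  have hatop : ∀ l, a l ≠ ∞ := fun l => levelPartitionProb_gem_ne_top _ (hγ l) (hα l) _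
  have hptop : ∏ l, a l ≠ ∞ := ENNReal.prod_ne_top fun l _ => hatop l
  have hadd : Tendsto (fun δ : ℝ≥0∞ => ∏ l, (a l + δ)) (𝓝[>] 0) (𝓝 (∏ l, a l)) := by
    refine ENNReal.tendsto_finsetProd_of_ne_top _ (fun l _ => ?_) fun l _ => hatop l
    have : Tendsto (fun δ : ℝ≥0∞ => a l + δ) (𝓝 0) (𝓝 (a l + 0)) :=
      tendsto_const_nhds.add tendsto_id
    rw [add_zero] at this
    exact this.mono_left nhdsWithin_le_nhds
  have hsub : Tendsto (fun δ : ℝ≥0∞ => ∏ l, (a l - δ)) (𝓝[>] 0) (𝓝 (∏ l, a l)) := by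
    refine ENNReal.tendsto_finsetProd_of_ne_top _ (fun l _ => ?_) fun l _ => hatop l
    have : Tendsto (fun δ : ℝ≥0∞ => a l - δ) (𝓝 0) (𝓝 (a l - 0)) :=
      ENNReal.Tendsto.sub tendsto_const_nhds tendsto_id (.inl (hatop l))
    rw [tsub_zero] at this
    exact this.mono_left nhdsWithin_le_nhds
  have hne : (𝓝[>] (0 : ℝ≥0∞)).NeBot := nhdsGT_neBot_of_exists_gt ⟨1, one_pos⟩
  -- A tolerance `δ > 0` per level, so small that both products of perturbed factors stay within `η`
  -- of the exact product.
  obtain ⟨δ, ⟨hδ1, hδ2⟩, hδ⟩ := ((((ENNReal.tendsto_nhds hptop).1 hadd η hη).and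
    ((ENNReal.tendsto_nhds hptop).1 hsub η hη)).and self_mem_nhdsWithin).exists
  choose n hn using fun l => exists_tsum_finiteLevel_mem_Icc (hγ l) (hα l)
    (enteredPartition N R l) (R l) hδ
  refine ⟨Finset.univ.sup n + 1, fun K T hK hT => ?_⟩
  have hn' : ∀ l, n l ≤ Finset.univ.sup n := fun l => Finset.le_sup (Finset.mem_univ l)
  have h := chain_mem_Icc
    (fun l r k => ∫⁻ G, ∏ c : Customer M N, G (r c) {k c}
      ∂(finiteLevel (γ l) (α l) (K l) (T l)))
    (fun l r => ∀ c, r c < numRestaurants M K l) R (fun l => a l - δ) (fun l => a l + δ)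
    (fun c => (c.1 : ℕ))
    (fun l hl c => by
      have : numRestaurants M K l = M := dif_neg (by omega)
      rw [this]
      exact c.1.2)
    (fun l r hr hker => hn l (K l) (T l) r ((hn' l).trans (by have := hK l; omega))
      (fun c => (hn' l).trans (by have := hT l (r c) (hr c); omega)) hker)
    (fun l r k hk l' hl' c => by
      by_contra hc
      have h1 : numRestaurants M K l' = K l := by
        have h2 : (l' : ℕ) + 1 < L + 1 := by omega
        exact (dif_pos h2).trans (congrArg K (Fin.ext hl'))
      rw [h1, not_lt] at hc
      exact hk (finiteLevel_eq_zero (hγ l) (hα l) (by have := hK l; omega) (T l) hc))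
  exact ⟨hδ2.1.trans h.1, h.2.trans hδ1.2⟩

end Chain

/-! ### Total variation convergence of the outcome -/

theorem isProbabilityMeasure_nHDPLevel {γ α : ℝ} (hγ : 0 < γ) (hα : 0 < α) :
    IsProbabilityMeasure (nHDPLevel γ α) := by
  have := isProbabilityMeasure_gem hγ
  have := isProbabilityMeasure_gem hα
  exact isProbabilityMeasure_levelLaw (ae_gem_tsum_eq hγ) fun _ => gem α

theorem isProbabilityMeasure_finiteLevel {γ α : ℝ} (hγ : 0 < γ) (hα : 0 < α) {K : ℕ}
    (hK : 0 < K) (T : ℕ → ℕ) : IsProbabilityMeasure (finiteLevel γ α K T) := by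
  have := isProbabilityMeasure_symDirichlet hγ K
  have := fun r => isProbabilityMeasure_symDirichlet hα (T r)
  rw [finiteLevel_eq]
  exact isProbabilityMeasure_levelLaw (ae_symDirichlet_tsum_eq hγ hK) _

theorem abs_toReal_sub_le {x y : ℝ≥0∞} {ε : ℝ} (hε : 0 ≤ ε) (hy : y ≠ ∞)
    (h1 : x ≤ y + ENNReal.ofReal ε) (h2 : y ≤ x + ENNReal.ofReal ε) :
    |x.toReal - y.toReal| ≤ ε := by
  have hx : x ≠ ∞ := (h1.trans_lt (ENNReal.add_lt_top.2 ⟨hy.lt_top, ENNReal.ofReal_lt_top⟩)).ne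
  have h3 := ENNReal.toReal_mono (by finiteness) h1
  have h4 := ENNReal.toReal_mono (by finiteness) h2
  rw [ENNReal.toReal_add (by finiteness) (by finiteness), ENNReal.toReal_ofReal hε] at h3 h4
  rw [abs_le]
  constructor <;> linarith

/-- Convergence in total variation of mixtures, given convergence of the weights. -/
theorem sum_mul_le_of_le_add {ι : Type*} [Fintype ι] {p p' κ : ι → ℝ≥0∞} {η : ℝ≥0∞}
    (hp : ∀ i, p i ≤ p' i + η) (hκ : ∀ i, κ i ≤ 1) :
    ∑ i, p i * κ i ≤ ∑ i, p' i * κ i + Fintype.card ι * η := by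
  calc ∑ i, p i * κ i ≤ ∑ i, (p' i * κ i + η) := Finset.sum_le_sum fun i _ =>
        calc p i * κ i ≤ (p' i + η) * κ i := mul_le_mul_left (hp i) _
          _ = p' i * κ i + η * κ i := add_mul _ _ _
          _ ≤ p' i * κ i + η := by
            gcongr
            exact mul_le_of_le_one_right zero_le (hκ i)
    _ = _ := by rw [Finset.sum_add_distrib, Finset.sum_const, Finset.card_univ, nsmul_eq_mul]

theorem exists_abs_finiteLaw_sub_nHDPLaw_le {Θ X : Type*} [MeasurableSpace Θ] [MeasurableSpace X]
    (L M : ℕ) (N : Fin M → ℕ)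
    (γ α : Fin (L + 1) → ℝ) (hγ : ∀ l, 0 < γ l) (hα : ∀ l, 0 < α l)
    (H : Measure Θ) [IsProbabilityMeasure H] (F : Kernel Θ X) [IsMarkovKernel F]
    {ε : ℝ} (hε : 0 < ε) : ∃ n : ℕ, ∀ (K : Fin (L + 1) → ℕ) (T : Fin (L + 1) → ℕ → ℕ),
      (∀ l, n ≤ K l) → (∀ l r, r < numRestaurants M K l → n ≤ T l r) →
      ∀ A : Set (Outcome L M N Θ X), MeasurableSet A →
        |(finiteLaw N γ α H F K T).real A - (nHDPLaw N γ α H F).real A| ≤ ε := by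
  -- Each of the `m` mixture weights may be off by `ε / m`. The conditional probabilities are at
  -- most 1, so the total error is at most `ε`, whatever the event `A`.
  set m := Fintype.card (Fin (L + 1) → Setoid (Customer M N)) with hm
  have hm0 : 0 < m := Fintype.card_pos_iff.2 ⟨fun _ => ⊥⟩
  have hη : 0 < ENNReal.ofReal (ε / m) := ENNReal.ofReal_pos.2 (by positivity)
  have hmη : (m : ℝ≥0∞) * ENNReal.ofReal (ε / m) = ENNReal.ofReal ε := by
    rw [← ENNReal.ofReal_natCast, ← ENNReal.ofReal_mul (by positivity)]
    congr 1
    field_simp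
  choose n hn using fun R => exists_dishPartitionProb_mem_Icc N hγ hα R hη
  refine ⟨Finset.univ.sup n + 1, fun K T hK hT A hA => ?_⟩
  have hn' : ∀ R, n R ≤ Finset.univ.sup n := fun R => Finset.le_sup (Finset.mem_univ R)
  have := fun l => isProbabilityMeasure_nHDPLevel (hγ l) (hα l)
  have := fun l => isProbabilityMeasure_finiteLevel (hγ l) (hα l)
    (show 0 < K l by have := hK l; omega) (T l)
  have hIcc := fun R => hn R K T (fun l => (hn' R).trans (by have := hK l; omega))
    fun l r hr => (hn' R).trans (by have := hT l r hr; omega)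
  rw [measureReal_def, measureReal_def, finiteLaw, nHDPLaw, outcomeLaw_apply N _ H F hA,
    outcomeLaw_apply N _ H F hA]
  have hκ := fun R => outcomeGiven_le_one N H F R A
  refine abs_toReal_sub_le hε.le ?_ ?_ ?_
  · refine ENNReal.sum_ne_top.2 fun R _ => ENNReal.mul_ne_top ?_
      ((hκ R).trans_lt ENNReal.one_lt_top).ne
    rw [dishPartitionProb_nHDPLevel N hγ hα]
    exact ENNReal.prod_ne_top fun l _ => levelPartitionProb_gem_ne_top _ (hγ l) (hα l) _
  · rw [← hmη, hm]
    exact sum_mul_le_of_le_add (fun R => (hIcc R).2) hκ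
  · rw [← hmη, hm]
    exact sum_mul_le_of_le_add (fun R => tsub_le_iff_right.1 (hIcc R).1) hκ

end

end NHDP

theorem theorem2 {Θ X : Type*} [MeasurableSpace Θ] [MeasurableSpace X]
    (L M : ℕ) (N : Fin M → ℕ)
    (γ α : Fin (L + 1) → ℝ) (hγ : ∀ l, 0 < γ l) (hα : ∀ l, 0 < α l)
    (H : MeasureTheory.Measure Θ) [MeasureTheory.IsProbabilityMeasure H]
    (F : ProbabilityTheory.Kernel Θ X) [ProbabilityTheory.IsMarkovKernel F] :
    ∀ ε : ℝ, 0 < ε → ∃ n : ℕ, ∀ (K : Fin (L + 1) → ℕ) (T : Fin (L + 1) → ℕ → ℕ),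
      (∀ l, n ≤ K l) → (∀ l r, r < NHDP.numRestaurants M K l → n ≤ T l r) →
      ∀ A : Set (NHDP.Outcome L M N Θ X), MeasurableSet A →
        |(NHDP.finiteLaw N γ α H F K T).real A - (NHDP.nHDPLaw N γ α H F).real A| ≤ ε := by
  intro ε hε
  exact NHDP.exists_abs_finiteLaw_sub_nHDPLaw_le L M N γ α hγ hα H F hε
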